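/- For an integer $n\ge 1$ and $p\in[0,1]$, the Distributional Boolean Hidden Partition problem is the following two-player problem. Alice receives a uniformly random vector $x\in\{0,1\}^n$. Bob receives a random graph $G\sim\mathcal G_{n,p}$ on the vertex set $[n]$, in which each potential edge is present independently with probability $p$, together with a vector $w$ having one bit for each edge of $G$. Let $M$ be the edge incidence matrix of $G$, that is, $M_{ev}=1$ if the vertex $v$ is an endpoint of the edge $e$, and $M_{ev}=0$ otherwise. The answer is YES or NO, with probability $1/2$ each; $x$, $G$ and the answer are independent. If the answer is YES, then $w=Mx$ over $\mathbb{GF}(2)$; if the answer is NO, then $w$ is uniformly random in $\{0,1\}^{E(G)}$, independently of $x$. In a (possibly randomized) one-way protocol, Alice sends Bob a bit string that depends on $x$, and Bob, from this message and $(G,w)$, guesses the answer; both players may use random coins, private or shared, that are independent of the input. The protocol uses at most $c$ bits if the length of the message never exceeds $c$, and it achieves advantage $\delta$ over random guessing if Bob's guess is correct with probability at least $1/2+\delta$ over the input and the coins. **Lemma 4.1.** There is an absolute constant $C>0$ such that for every integer $n\ge 1$, every $\gamma\in(n^{-1/10},1)$ and every $\alpha\in(n^{-1/10},1/16)$ the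 following holds. If a one-way protocol for the Distributional Boolean Hidden Partition problem with $G\sim\mathcal G_{n,\alpha/n}$ uses at most $\gamma\sqrt n$ bits of communication and achieves advantage $\delta$ over random guessing, then $\delta\le C\,(\gamma+\alpha^{3/2})$. -/

import Mathlib

open MeasureTheory
open scoped Matrix

/-- The edge incidence matrix of `G` over `GF(2)`: rows are indexed by the edges of `G`, columns
by the vertices, and the entry at `(e, v)` is `1` iff `v` is an endpoint of `e`. -/
def edgeIncidence {n : ℕ} (G : SimpleGraph (Fin n)) : Matrix G.edgeSet (Fin n) (ZMod 2) :=
  Matrix.of fun e v => if v ∈ (e : Sym2 (Fin n)) then 1 else 0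

/-- An instance of the Boolean Hidden Partition problem together with its answer:
Alice's vector `x`, Bob's graph `G` on `n` vertices, Bob's vector `w` (one bit for each edge of
`G`), and the answer (`true` for YES, `false` for NO). -/
structure BHPInstance (n : ℕ) where
  x : Fin n → ZMod 2
  G : SimpleGraph (Fin n)
  w : G.edgeSet → ZMod 2
  answer : Bool

open Classical in
/-- The distribution of Bob's vector given `x`, `G` and the answer: it is `M x` in the YES case,
and uniform (independently of `x`) in the NO case. -/
noncomputable def bobVector {n : ℕ} (x : Fin n → ZMod 2) (G : SimpleGraph (Fin n)) :
    Bool → PMF (G.edgeSet → ZMod 2)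
  | true => PMF.pure (edgeIncidence G *ᵥ x)
  | false => PMF.uniformOfFintype (G.edgeSet → ZMod 2)

instance instMeasurableSingletonClassSimpleGraphFin (n : ℕ) :
    MeasurableSingletonClass (SimpleGraph (Fin n)) where
  measurableSet_singleton G := by
    have h : ({G} : Set (SimpleGraph (Fin n))) = SimpleGraph.edgeSet ⁻¹' {G.edgeSet} := by
      ext H
      simp
    rw [h]
    exact SimpleGraph.measurable_edgeSet (measurableSet_singleton _)

/-- The input distribution of the Distributional Boolean Hidden Partition problem: independently,
`x` is uniform, `G` is a random graph in which each potential edge is present independently with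
probability `p`, and the answer is a fair coin; then `w` is drawn according to the answer. -/
noncomputable def dbhp (n : ℕ) (p : unitInterval) : PMF (BHPInstance n) :=
  (PMF.uniformOfFintype (Fin n → ZMod 2)).bind fun x =>
    (SimpleGraph.binomialRandom (Fin n) p).toPMF.bind fun G =>
      (PMF.uniformOfFintype Bool).bind fun b =>
        (bobVector x G b).map fun w => ⟨x, G, w, b⟩

/-- A randomized one-way protocol. The sample space `Ω` carries all the random coins, which both
players may read (deterministic protocols and private coins are special cases). Alice's message is
a bit string that depends on the coins and on `x`. Bob outputs a guess (`true` for YES) that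
depends on the coins, on his input `(G, w)`, and on the message. -/
structure OneWayProtocol (n : ℕ) (Ω : Type*) [MeasurableSpace Ω] where
  alice : Ω → (Fin n → ZMod 2) → List Bool
  bob : Ω → (G : SimpleGraph (Fin n)) → (G.edgeSet → ZMod 2) → List Bool → Bool
  measurableSet_alice : ∀ x m, MeasurableSet {ω | alice ω x = m}
  measurableSet_bob : ∀ G w m, MeasurableSet {ω | bob ω G w m = true}

namespace OneWayProtocol

variable {n : ℕ} {Ω : Type*} [MeasurableSpace Ω]

/-- The protocol uses at most `c` bits of communication: every message has length at most `c`. -/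
def UsesAtMost (P : OneWayProtocol n Ω) (c : ℝ) : Prop :=
  ∀ ω x, ((P.alice ω x).length : ℝ) ≤ c

/-- The output of the protocol on an instance, for given coins. -/
def output (P : OneWayProtocol n Ω) (ω : Ω) (I : BHPInstance n) : Bool :=
  P.bob ω I.G I.w (P.alice ω I.x)

/-- The probability that the protocol outputs the correct answer on a random instance of the
distributional problem, over the instance and the (independent) coins with law `μ`. -/
noncomputable def successProb (P : OneWayProtocol n Ω) (μ : Measure Ω) (p : unitInterval) : ℝ :=
  (∑' I : BHPInstance n, dbhp n p I * μ {ω | P.output ω I = I.answer}).toReal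

/-- The protocol achieves advantage `δ` over random guessing. -/
def AchievesAdvantage (P : OneWayProtocol n Ω) (μ : Measure Ω) (p : unitInterval) (δ : ℝ) : Prop :=
  1 / 2 + δ ≤ P.successProb μ p

end OneWayProtocol

/-!
A one-way protocol with few bits splits Alice's cube `(ZMod 2)^n` into few message classes, so
that, up to a total mass of order `γ`, she is uniform in a set `A` of density at least `2 ^ (-c)`
with `c` of order `γ√n`. For fixed `A` and `G`, the advantage of a test of Bob's is at most the
square root of the normalized collision excess `2 ^ |E(G)| * P(M x = M y) - 1`, with `x`, `y`
independent and uniform in `A` (`sq_hit_sub_le_collision`).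

With `σ i = (-1) ^ (x i + y i)`, the collision indicator times `2 ^ |E(G)|` is the product over
the edges `uv` of `G` of `1 + σ u * σ v`. The edges of `G` are independent, so the average over `G`
is the product of `1 + p * σ u * σ v` over *all* pairs (`sum_binomialRandom_mul_prod`). This is
the partition function of a mean-field Ising model. It is at most an explicit constant times
`exp (p * S ^ 2 / 2)` with `S = ∑ i, σ i`, and the square is linearized by a Gaussian integral
of `cosh (√p * g * S)` over `g` (`integral_gaussian_mul_cosh`).

The average of `cosh (t * S)` over `x, y ∈ A` is `cosh t ^ n` times a sum over the even Fourier
levels of `A`, weighted by powers of `tanh t`. Level zero gives the Gaussian moment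
`(1 - α) ^ (-1/2)`; this cancels the explicit constant up to `1 + O(α ^ 3)`, a trace of the fact
that the shortest cycles are triangles. The levels from two on are controlled by hypercontractivity
on the cube (`hypercontractive`), used at the scale `tanh t ≈ 1 / c` and extrapolated downwards
quadratically (`evenExcess_le`); they contribute `O(c ^ 2 * p) = O(γ ^ 2)`. The square root of
`O(α ^ 3 + γ ^ 2)` is the bound.
-/

/-! ### The two-point inequality and hypercontractivity on the cube -/

theorem two_mul_mul_le_rpow_sub_rpow {q a : ℝ} (hq0 : 0 ≤ q) (hq1 : q ≤ 1) (ha0 : 0 ≤ a)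
    (ha1 : a ≤ 1) : 2 * q * a ≤ (1 + a) ^ q - (1 - a) ^ q := by
  rcases hq0.eq_or_lt with rfl | hq
  · simp
  have hmono : MonotoneOn (fun a : ℝ => (1 + a) ^ q - (1 - a) ^ q - 2 * q * a)
      (Set.Icc 0 1) := by
    apply monotoneOn_of_hasDerivWithinAt_nonneg (convex_Icc 0 1)
      (f' := fun a => q * ((1 + a) ^ (q - 1) + (1 - a) ^ (q - 1) - 2))
    · have h1 : Continuous fun a : ℝ => (1 + a) ^ q :=
        (continuous_const.add continuous_id).rpow_const fun _ => Or.inr hq0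
      have h2 : Continuous fun a : ℝ => (1 - a) ^ q :=
        (continuous_const.sub continuous_id).rpow_const fun _ => Or.inr hq0
      exact ((h1.sub h2).sub (by fun_prop)).continuousOn
    · intro x hx
      rw [interior_Icc] at hx
      have h1 : HasDerivAt (fun a : ℝ => (1 + a) ^ q) (1 * q * (1 + x) ^ (q - 1)) x :=
        ((hasDerivAt_id x).const_add 1).rpow_const (Or.inl (by simp; linarith [hx.1]))
      have h2 : HasDerivAt (fun a : ℝ => (1 - a) ^ q) (-1 * q * (1 - x) ^ (q - 1)) x :=
        ((hasDerivAt_id x).const_sub 1).rpow_const (Or.inl (by simp; linarith [hx.2]))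
      have h3 : HasDerivAt (fun a : ℝ => 2 * q * a) (2 * q * 1) x :=
        (hasDerivAt_id x).const_mul (2 * q)
      exact (((h1.sub h2).sub h3).congr_deriv (by ring)).hasDerivWithinAt
    · intro x hx
      rw [interior_Icc] at hx
      have hp : 0 < 1 + x := by linarith [hx.1]
      have hm : 0 < 1 - x := by linarith [hx.2]
      have hprod : 1 ≤ (1 + x) ^ (q - 1) * (1 - x) ^ (q - 1) := by
        rw [← Real.mul_rpow hp.le hm.le]
        exact Real.one_le_rpow_of_pos_of_le_one_of_nonpos (mul_pos hp hm)
          (by nlinarith [sq_nonneg x])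
          (by linarith)
      have hA := Real.rpow_pos_of_pos hp (q - 1)
      have hB := Real.rpow_pos_of_pos hm (q - 1)
      apply mul_nonneg hq0
      nlinarith [sq_nonneg ((1 + x) ^ (q - 1) - (1 - x) ^ (q - 1))]
  have := hmono (Set.left_mem_Icc.2 zero_le_one) ⟨ha0, ha1⟩ ha0
  simp at this
  linarith

theorem two_add_mul_sq_le_rpow_add_rpow {p a : ℝ} (hp1 : 1 ≤ p) (hp2 : p ≤ 2) (ha0 : 0 ≤ a)
    (ha1 : a ≤ 1) : 2 + p * (p - 1) * a ^ 2 ≤ (1 + a) ^ p + (1 - a) ^ p := by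
  have hmono : MonotoneOn (fun a : ℝ => (1 + a) ^ p + (1 - a) ^ p - p * (p - 1) * a ^ 2)
      (Set.Icc 0 1) := by
    apply monotoneOn_of_hasDerivWithinAt_nonneg (convex_Icc 0 1)
      (f' := fun a => p * ((1 + a) ^ (p - 1) - (1 - a) ^ (p - 1) - 2 * (p - 1) * a))
    · have h1 : Continuous fun a : ℝ => (1 + a) ^ p :=
        (continuous_const.add continuous_id).rpow_const fun _ => Or.inr (by linarith)
      have h2 : Continuous fun a : ℝ => (1 - a) ^ p :=
        (continuous_const.sub continuous_id).rpow_const fun _ => Or.inr (by linarith)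
      exact ((h1.add h2).sub (by fun_prop)).continuousOn
    · intro x hx
      have h1 : HasDerivAt (fun a : ℝ => (1 + a) ^ p) (1 * p * (1 + x) ^ (p - 1)) x :=
        ((hasDerivAt_id x).const_add 1).rpow_const (Or.inr hp1)
      have h2 : HasDerivAt (fun a : ℝ => (1 - a) ^ p) (-1 * p * (1 - x) ^ (p - 1)) x :=
        ((hasDerivAt_id x).const_sub 1).rpow_const (Or.inr hp1)
      have h3 : HasDerivAt (fun a : ℝ => p * (p - 1) * a ^ 2) (p * (p - 1) * (2 * x)) x := by
        simpa using (hasDerivAt_pow 2 x).const_mul (p * (p - 1))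
      exact (((h1.add h2).sub h3).congr_deriv (by ring)).hasDerivWithinAt
    · intro x hx
      rw [interior_Icc] at hx
      have := two_mul_mul_le_rpow_sub_rpow (q := p - 1) (by linarith) (by linarith) hx.1.le hx.2.le
      apply mul_nonneg (by linarith)
      linarith
  have := hmono (Set.left_mem_Icc.2 zero_le_one) ⟨ha0, ha1⟩ ha0
  simp at this
  linarith

/-- The two-point hypercontractive inequality, for nonnegative functions on a two-point space. -/
theorem two_point_inequality {ρ u v : ℝ} (hρ0 : 0 ≤ ρ) (hρ1 : ρ ≤ 1) (hu : 0 ≤ u) (hv : 0 ≤ v) :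
    (u + v) ^ 2 + ρ * (u - v) ^ 2 ≤
      4 * ((u ^ (1 + ρ) + v ^ (1 + ρ)) / 2) ^ (2 / (1 + ρ)) := by
  wlog huv : v ≤ u generalizing u v
  · have := this hv hu (le_of_not_ge huv)
    rw [add_comm (v ^ _)] at this
    nlinarith
  rcases hu.eq_or_lt with rfl | hu0
  · obtain rfl : v = 0 := le_antisymm huv hv
    have : (0 : ℝ) ≤ 4 * ((0 ^ (1 + ρ) + 0 ^ (1 + ρ)) / 2) ^ (2 / (1 + ρ)) := by positivity
    simpa using this
  set m : ℝ := (u + v) / 2 with hm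
  have hm0 : 0 < m := by positivity
  set a : ℝ := (u - v) / (u + v) with ha
  have ha0 : 0 ≤ a := div_nonneg (by linarith) (by linarith)
  have ha1 : a ≤ 1 := (div_le_one (by linarith)).2 (by linarith)
  have hu' : u = m * (1 + a) := by rw [hm, ha]; field_simp; ring
  have hv' : v = m * (1 - a) := by rw [hm, ha]; field_simp; ring
  have hp : 0 < 1 + ρ := by linarith
  -- concavity of `s ↦ s ^ (p / 2)` for `p = 1 + ρ ≤ 2` turns the claim into the scalar inequality
  have h1 : 1 + ρ * a ^ 2 ≤ (((1 + a) ^ (1 + ρ) + (1 - a) ^ (1 + ρ)) / 2) ^ (2 / (1 + ρ)) := by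
    have h2 : (1 + ρ * a ^ 2) ^ ((1 + ρ) / 2) ≤ 1 + ((1 + ρ) / 2) * (ρ * a ^ 2) :=
      rpow_one_add_le_one_add_mul_self (by nlinarith [sq_nonneg a]) (by linarith) (by linarith)
    have h3 := two_add_mul_sq_le_rpow_add_rpow (p := 1 + ρ) (by linarith) (by linarith) ha0 ha1
    have h4 : (1 + ρ * a ^ 2) ^ ((1 + ρ) / 2) ≤ ((1 + a) ^ (1 + ρ) + (1 - a) ^ (1 + ρ)) / 2 := by
      nlinarith
    have h5 : 0 ≤ 1 + ρ * a ^ 2 := by positivity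
    calc 1 + ρ * a ^ 2 = ((1 + ρ * a ^ 2) ^ ((1 + ρ) / 2)) ^ (2 / (1 + ρ)) := by
          rw [← Real.rpow_mul h5, show (1 + ρ) / 2 * (2 / (1 + ρ)) = 1 by field_simp, Real.rpow_one]
      _ ≤ _ := Real.rpow_le_rpow (by positivity) h4 (by positivity)
  have h1a : 0 ≤ 1 - a := by linarith
  have h6 : (u ^ (1 + ρ) + v ^ (1 + ρ)) / 2 =
      m ^ (1 + ρ) * (((1 + a) ^ (1 + ρ) + (1 - a) ^ (1 + ρ)) / 2) := by
    rw [hu', hv', Real.mul_rpow hm0.le (by linarith), Real.mul_rpow hm0.le h1a]; ring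
  rw [h6, Real.mul_rpow (by positivity) (by positivity), ← Real.rpow_mul hm0.le,
    show (1 + ρ) * (2 / (1 + ρ)) = 2 by field_simp]
  have h7 : m ^ (2 : ℝ) = m ^ 2 := by norm_cast
  rw [h7]
  calc (u + v) ^ 2 + ρ * (u - v) ^ 2 = 4 * (m ^ 2 * (1 + ρ * a ^ 2)) := by rw [hu', hv']; ring
    _ ≤ _ := by gcongr

/-- The character of `ZMod 2` with values `1` and `-1`. -/
noncomputable def chi (z : ZMod 2) : ℝ := if z = 0 then 1 else -1

@[simp] theorem chi_zero : chi 0 = 1 := by simp [chi]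
@[simp] theorem chi_one : chi 1 = -1 := by simp [chi]

theorem chi_eq_one_or (z : ZMod 2) : chi z = 1 ∨ chi z = -1 := by
  unfold chi; split_ifs <;> simp

theorem sum_zmod_two (f : ZMod 2 → ℝ) : ∑ a, f a = f 0 + f 1 := Fin.sum_univ_two f

/-- The two-function form of the two-point inequality; it is what tensorizes. -/
theorem two_point_bilinear {ρ : ℝ} (hρ0 : 0 ≤ ρ) (hρ1 : ρ ≤ 1) (F G : ZMod 2 → ℝ)
    (hF : ∀ a, 0 ≤ F a) (hG : ∀ a, 0 ≤ G a) :
    ∑ a, ∑ b, (1 + ρ * (chi a * chi b)) * (F a * G b) ≤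
      4 * (1 / 2 : ℝ) ^ (2 / (1 + ρ)) *
        ((∑ a, F a ^ (1 + ρ)) ^ (1 / (1 + ρ)) * (∑ a, G a ^ (1 + ρ)) ^ (1 / (1 + ρ))) := by
  simp only [sum_zmod_two, chi_zero, chi_one]
  have key : ∀ u v : ℝ, 0 ≤ u → 0 ≤ v → (u + v) ^ 2 + ρ * (u - v) ^ 2 ≤
      4 * (1 / 2 : ℝ) ^ (2 / (1 + ρ)) * ((u ^ (1 + ρ) + v ^ (1 + ρ)) ^ (1 / (1 + ρ))) ^ 2 := by
    intro u v hu hv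
    have h := two_point_inequality hρ0 hρ1 hu hv
    have hs : 0 ≤ u ^ (1 + ρ) + v ^ (1 + ρ) := by positivity
    rw [div_eq_mul_one_div, mul_comm _ (1 / 2 : ℝ), Real.mul_rpow (by norm_num) hs] at h
    rw [← Real.rpow_natCast ((u ^ (1 + ρ) + v ^ (1 + ρ)) ^ (1 / (1 + ρ))), ← Real.rpow_mul hs,
      show 1 / (1 + ρ) * ((2 : ℕ) : ℝ) = 2 / (1 + ρ) by push_cast; ring]
    linarith
  have hf := key (F 0) (F 1) (hF 0) (hF 1)
  have hg := key (G 0) (G 1) (hG 0) (hG 1)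
  set N := (F 0 ^ (1 + ρ) + F 1 ^ (1 + ρ)) ^ (1 / (1 + ρ))
  set M := (G 0 ^ (1 + ρ) + G 1 ^ (1 + ρ)) ^ (1 / (1 + ρ))
  have hN : 0 ≤ N := by
    have := hF 0; have := hF 1; positivity
  have hM : 0 ≤ M := by
    have := hG 0; have := hG 1; positivity
  set K := 4 * (1 / 2 : ℝ) ^ (2 / (1 + ρ))
  have hK : 0 ≤ K := by positivity
  -- Cauchy–Schwarz for the positive semidefinite form `(u₀ + u₁)(v₀ + v₁) + ρ (u₀ - u₁)(v₀ - v₁)`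
  have hcs : ((F 0 + F 1) * (G 0 + G 1) + ρ * ((F 0 - F 1) * (G 0 - G 1))) ^ 2 ≤
      (K * (N * M)) ^ 2 := by
    calc _ ≤ ((F 0 + F 1) ^ 2 + ρ * (F 0 - F 1) ^ 2) * ((G 0 + G 1) ^ 2 + ρ * (G 0 - G 1) ^ 2) := by
          nlinarith [mul_nonneg hρ0
            (sq_nonneg ((F 0 + F 1) * (G 0 - G 1) - (F 0 - F 1) * (G 0 + G 1)))]
      _ ≤ (K * N ^ 2) * (K * M ^ 2) := by gcongr
      _ = _ := by ring
  have := abs_le_of_sq_le_sq' hcs (by positivity)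
  linarith [this.2]

theorem sum_fin_succ_pi {n : ℕ} (f : (Fin (n + 1) → ZMod 2) → ℝ) :
    ∑ x, f x = ∑ a : ZMod 2, ∑ x : Fin n → ZMod 2, f (Fin.cons a x) := by
  rw [← Fintype.sum_prod_type', ← (Fin.consEquiv fun _ => ZMod 2).sum_comp]
  rfl

/-- The hypercontractive inequality on the cube, in two-function form for nonnegative functions and
unnormalized sums, with exponent `1 + ρ` on both sides. The constant `4 * (1 / 2) ^ (2 / (1 + ρ))`
only accounts for the missing normalization. The two-function form makes the induction on the
dimension immediate: fix the first coordinates and apply the induction hypothesis to the slices. -/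
theorem hypercontractive {ρ : ℝ} (hρ0 : 0 ≤ ρ) (hρ1 : ρ ≤ 1) {n : ℕ}
    (f g : (Fin n → ZMod 2) → ℝ) (hf : ∀ x, 0 ≤ f x) (hg : ∀ x, 0 ≤ g x) :
    ∑ x, ∑ y, (∏ i, (1 + ρ * (chi (x i) * chi (y i)))) * (f x * g y) ≤
      (4 * (1 / 2 : ℝ) ^ (2 / (1 + ρ))) ^ n *
        ((∑ x, f x ^ (1 + ρ)) ^ (1 / (1 + ρ)) * (∑ x, g x ^ (1 + ρ)) ^ (1 / (1 + ρ))) := by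
  have hp : 0 < 1 + ρ := by linarith
  induction n with
  | zero =>
    simp only [Finset.univ_unique, Finset.sum_singleton, Finset.univ_eq_empty, Finset.prod_empty,
      pow_zero, one_mul]
    rw [← Real.rpow_mul (hf _), ← Real.rpow_mul (hg _), mul_one_div_cancel hp.ne', Real.rpow_one,
      Real.rpow_one]
  | succ n ih =>
    set K := 4 * (1 / 2 : ℝ) ^ (2 / (1 + ρ))
    have hK : 0 ≤ K := by positivity
    set F : ZMod 2 → ℝ := fun a => (∑ x : Fin n → ZMod 2, f (Fin.cons a x) ^ (1 + ρ)) ^ (1 / (1 + ρ))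
    set G : ZMod 2 → ℝ := fun a => (∑ x : Fin n → ZMod 2, g (Fin.cons a x) ^ (1 + ρ)) ^ (1 / (1 + ρ))
    have hsf : ∀ a, 0 ≤ ∑ x : Fin n → ZMod 2, f (Fin.cons a x) ^ (1 + ρ) :=
      fun a => Finset.sum_nonneg fun x _ => Real.rpow_nonneg (hf _) _
    have hsg : ∀ a, 0 ≤ ∑ x : Fin n → ZMod 2, g (Fin.cons a x) ^ (1 + ρ) :=
      fun a => Finset.sum_nonneg fun x _ => Real.rpow_nonneg (hg _) _
    have hFp : ∀ a, F a ^ (1 + ρ) = ∑ x : Fin n → ZMod 2, f (Fin.cons a x) ^ (1 + ρ) := fun a => by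
      rw [← Real.rpow_mul (hsf a), one_div_mul_cancel hp.ne', Real.rpow_one]
    have hGp : ∀ a, G a ^ (1 + ρ) = ∑ x : Fin n → ZMod 2, g (Fin.cons a x) ^ (1 + ρ) := fun a => by
      rw [← Real.rpow_mul (hsg a), one_div_mul_cancel hp.ne', Real.rpow_one]
    have h2 := two_point_bilinear hρ0 hρ1 F G (fun a => Real.rpow_nonneg (hsf a) _)
      (fun a => Real.rpow_nonneg (hsg a) _)
    simp only [hFp, hGp] at h2
    rw [sum_fin_succ_pi]
    simp_rw [sum_fin_succ_pi (n := n), Fin.prod_univ_succ, Fin.cons_zero, Fin.cons_succ]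
    calc _ = ∑ a, ∑ b, (1 + ρ * (chi a * chi b)) * ∑ x : Fin n → ZMod 2, ∑ y : Fin n → ZMod 2,
            (∏ i, (1 + ρ * (chi (x i) * chi (y i)))) * (f (Fin.cons a x) * g (Fin.cons b y)) := by
          refine Finset.sum_congr rfl fun a _ => ?_
          rw [Finset.sum_comm]
          simp only [Finset.mul_sum, mul_assoc]
      _ ≤ ∑ a, ∑ b, (1 + ρ * (chi a * chi b)) * (K ^ n * (F a * G b)) := by
          gcongr with a _ b _
          · rcases chi_eq_one_or a with h | h <;> rcases chi_eq_one_or b with h' | h' <;>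
              rw [h, h'] <;> linarith
          · exact ih (fun x => f (Fin.cons a x)) (fun x => g (Fin.cons b x)) (fun _ => hf _)
              (fun _ => hg _)
      _ = K ^ n * ∑ a, ∑ b, (1 + ρ * (chi a * chi b)) * (F a * G b) := by
          simp only [Finset.mul_sum]
          exact Finset.sum_congr rfl fun a _ => Finset.sum_congr rfl fun b _ => by ring
      _ ≤ K ^ n * (K * _) := by gcongr
      _ = _ := by rw [pow_succ]; ring

/-- Two uniform points of a set of density at least `2 ^ (-c)` have noise correlation at most
`2 ^ (2 * c * ρ)`. -/
theorem sum_prod_one_add_le {n : ℕ} {A : Finset (Fin n → ZMod 2)} {c ρ : ℝ} (hρ0 : 0 ≤ ρ)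
    (hρ1 : ρ ≤ 1) (hc : 0 ≤ c) (hA : (2 : ℝ) ^ n ≤ A.card * 2 ^ c) :
    ∑ x ∈ A, ∑ y ∈ A, ∏ i, (1 + ρ * (chi (x i) * chi (y i))) ≤
      (A.card : ℝ) ^ 2 * 2 ^ (2 * c * ρ) := by
  classical
  have hp : 0 < 1 + ρ := by linarith
  have hApos : 0 < (A.card : ℝ) := by
    have : (0 : ℝ) < A.card * 2 ^ c := lt_of_lt_of_le (by positivity) hA
    exact pos_of_mul_pos_left this (by positivity)
  have h := hypercontractive hρ0 hρ1 (fun x => if x ∈ A then (1 : ℝ) else 0)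
    (fun x => if x ∈ A then (1 : ℝ) else 0) (fun x => by positivity) (fun x => by positivity)
  have hs : ∑ x : Fin n → ZMod 2, (if x ∈ A then (1 : ℝ) else 0) ^ (1 + ρ) = A.card := by
    have : ∀ x, (if x ∈ A then (1 : ℝ) else 0) ^ (1 + ρ) = if x ∈ A then (1 : ℝ) else 0 := by
      intro x; split_ifs
      · simp
      · exact Real.zero_rpow hp.ne'
    simp [this]
  rw [hs] at h
  have hl : ∑ x ∈ A, ∑ y ∈ A, ∏ i, (1 + ρ * (chi (x i) * chi (y i))) =
      ∑ x, ∑ y, (∏ i, (1 + ρ * (chi (x i) * chi (y i)))) *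
        ((if x ∈ A then (1 : ℝ) else 0) * (if y ∈ A then (1 : ℝ) else 0)) := by
    simp [Finset.sum_ite_mem]
  rw [hl]
  refine h.trans ?_
  have e1 : (4 * (1 / 2 : ℝ) ^ (2 / (1 + ρ))) = 2 ^ (2 * ρ / (1 + ρ)) := by
    rw [show (4 : ℝ) = 2 ^ (2 : ℝ) by norm_num, one_div, Real.inv_rpow (by norm_num),
      ← Real.rpow_neg (by norm_num), ← Real.rpow_add (by norm_num)]
    congr 1; field_simp; ring
  rw [e1, ← Real.rpow_natCast, ← Real.rpow_mul (by norm_num), mul_comm _ (n : ℝ),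
    Real.rpow_mul (by norm_num), Real.rpow_natCast, ← Real.rpow_add hApos]
  calc _ ≤ ((A.card : ℝ) * 2 ^ c) ^ (2 * ρ / (1 + ρ)) *
        (A.card : ℝ) ^ (1 / (1 + ρ) + 1 / (1 + ρ)) := by gcongr
    _ = (A.card : ℝ) ^ 2 * 2 ^ (c * (2 * ρ / (1 + ρ))) := by
      rw [Real.mul_rpow hApos.le (by positivity), mul_right_comm, ← Real.rpow_add hApos,
        ← Real.rpow_mul (by norm_num),
        show 2 * ρ / (1 + ρ) + (1 / (1 + ρ) + 1 / (1 + ρ)) = (2 : ℕ) by push_cast; field_simp; ring,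
        Real.rpow_natCast]
    _ ≤ _ := by
      have h1 : 2 * ρ / (1 + ρ) ≤ 2 * ρ := div_le_self (by linarith) (by linarith)
      exact mul_le_mul_of_nonneg_left
        (Real.rpow_le_rpow_of_exponent_le (by norm_num) (by nlinarith)) (by positivity)

/-! ### Even Fourier levels of a dense set -/

theorem tanh_nonneg_of_nonneg {t : ℝ} (ht : 0 ≤ t) : 0 ≤ Real.tanh t := by
  rw [Real.tanh_eq_sinh_div_cosh]
  exact div_nonneg (Real.sinh_nonneg_iff.2 ht) (Real.cosh_pos t).le

theorem tanh_le_self_of_nonneg {t : ℝ} (ht : 0 ≤ t) : Real.tanh t ≤ t := by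
  rw [Real.tanh_eq_sinh_div_cosh, div_le_iff₀ (Real.cosh_pos t)]
  have hmono : MonotoneOn (fun t : ℝ => t * Real.cosh t - Real.sinh t) (Set.Ici 0) := by
    apply monotoneOn_of_hasDerivWithinAt_nonneg (convex_Ici 0)
      (f' := fun t => t * Real.sinh t)
    · fun_prop
    · intro x _
      exact ((((hasDerivAt_id x).mul (Real.hasDerivAt_cosh x)).sub
        (Real.hasDerivAt_sinh x)).congr_deriv (by simp)).hasDerivWithinAt
    · intro x hx
      rw [interior_Ici] at hx
      exact mul_nonneg (le_of_lt hx) (Real.sinh_nonneg_iff.2 (le_of_lt hx))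
  have := hmono Set.self_mem_Ici ht ht
  simp at this
  linarith

/-- The inner product of the sign vectors of `x` and `y`. -/
noncomputable def signCorr {n : ℕ} (x y : Fin n → ZMod 2) : ℝ := ∑ i, chi (x i) * chi (y i)

/-- The (unnormalized) Fourier coefficient at `v` of the indicator function of `A`. -/
noncomputable def cubeCoeff {n : ℕ} (A : Finset (Fin n → ZMod 2)) (v : Finset (Fin n)) : ℝ :=
  ∑ x ∈ A, ∏ i ∈ v, chi (x i)

theorem sum_prod_one_add_eq {n : ℕ} (A : Finset (Fin n → ZMod 2)) (ρ : ℝ) :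
    ∑ x ∈ A, ∑ y ∈ A, ∏ i, (1 + ρ * (chi (x i) * chi (y i))) =
      ∑ v : Finset (Fin n), ρ ^ v.card * cubeCoeff A v ^ 2 := by
  simp_rw [Finset.prod_one_add, Finset.powerset_univ, Finset.prod_mul_distrib, Finset.prod_const,
    cubeCoeff, sq, Finset.sum_mul_sum, Finset.mul_sum]
  rw [Finset.sum_comm]
  conv_rhs => rw [Finset.sum_comm]
  rw [Finset.sum_comm]
  refine Finset.sum_congr rfl fun x _ => ?_
  rw [Finset.sum_comm]

/-- The part of the noise correlation of `A` that comes from the nonempty sets of even size. -/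
noncomputable def evenExcess {n : ℕ} (A : Finset (Fin n → ZMod 2)) (ρ : ℝ) : ℝ :=
  ∑ v : Finset (Fin n) with v ≠ ∅ ∧ Even v.card, ρ ^ v.card * cubeCoeff A v ^ 2

theorem half_sum_eq_evenExcess {n : ℕ} (A : Finset (Fin n → ZMod 2)) (ρ : ℝ) :
    (∑ x ∈ A, ∑ y ∈ A, ∏ i, (1 + ρ * (chi (x i) * chi (y i))) +
      ∑ x ∈ A, ∑ y ∈ A, ∏ i, (1 + -ρ * (chi (x i) * chi (y i)))) / 2 =
      (A.card : ℝ) ^ 2 + evenExcess A ρ := by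
  rw [sum_prod_one_add_eq, sum_prod_one_add_eq, ← Finset.sum_add_distrib, Finset.sum_div,
    evenExcess, Finset.sum_filter, ← Finset.add_sum_erase _ _ (Finset.mem_univ ∅),
    ← Finset.add_sum_erase (a := ∅) _ _ (Finset.mem_univ ∅)]
  have h0 : cubeCoeff A ∅ = A.card := by simp [cubeCoeff]
  rw [h0, if_neg (by simp), zero_add]
  congr 1
  · simp
  · refine Finset.sum_congr rfl fun v hv => ?_
    have hv' : v ≠ ∅ := Finset.ne_of_mem_erase hv
    rcases Nat.even_or_odd v.card with h | h
    · rw [if_pos ⟨hv', h⟩, h.neg_pow]; ring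
    · rw [if_neg fun h' => Nat.not_even_iff_odd.2 h h'.2, h.neg_pow]; ring

theorem evenExcess_nonneg {n : ℕ} (A : Finset (Fin n → ZMod 2)) {ρ : ℝ} (hρ : 0 ≤ ρ) :
    0 ≤ evenExcess A ρ := Finset.sum_nonneg fun v _ => by positivity

theorem evenExcess_le_of_density {n : ℕ} {A : Finset (Fin n → ZMod 2)} {c ρ : ℝ} (hρ0 : 0 ≤ ρ)
    (hρ1 : ρ ≤ 1) (hc : 0 ≤ c) (hA : (2 : ℝ) ^ n ≤ A.card * 2 ^ c) :
    evenExcess A ρ ≤ (A.card : ℝ) ^ 2 * 2 ^ (2 * c * ρ) := by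
  refine le_trans ?_ (sum_prod_one_add_le hρ0 hρ1 hc hA)
  rw [sum_prod_one_add_eq]
  exact Finset.sum_le_sum_of_subset_of_nonneg (Finset.filter_subset _ _) fun v _ _ => by positivity

/-- All frequencies in `evenExcess` have weight at least two, so it decays quadratically. -/
theorem evenExcess_scale {n : ℕ} (A : Finset (Fin n → ZMod 2)) {s r : ℝ} (hs0 : 0 ≤ s)
    (hs1 : s ≤ 1) (hr : 0 ≤ r) : evenExcess A (s * r) ≤ s ^ 2 * evenExcess A r := by
  rw [evenExcess, evenExcess, Finset.mul_sum]
  refine Finset.sum_le_sum fun v hv => ?_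
  simp only [Finset.mem_filter, Finset.mem_univ, true_and] at hv
  have h2 : 2 ≤ v.card := by
    have h0 : 0 < v.card := Finset.card_pos.2 (Finset.nonempty_iff_ne_empty.2 hv.1)
    obtain ⟨k, hk⟩ := hv.2
    omega
  rw [mul_pow, ← mul_assoc]
  have := pow_le_pow_of_le_one hs0 hs1 h2
  gcongr

/-- The level inequality for the even levels. Below the scale `1 / c` it follows from the
quadratic decay, above it from hypercontractivity alone. -/
theorem evenExcess_le {n : ℕ} {A : Finset (Fin n → ZMod 2)} {c ρ : ℝ} (hρ0 : 0 ≤ ρ)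
    (hρ1 : ρ ≤ 1) (hc : 1 ≤ c) (hA : (2 : ℝ) ^ n ≤ A.card * 2 ^ c) :
    evenExcess A ρ ≤ (A.card : ℝ) ^ 2 * (4 * (c * ρ) ^ 2 * 4 ^ (c * ρ)) := by
  have hc0 : 0 < c := by linarith
  have h4 : (1 : ℝ) ≤ 4 ^ (c * ρ) := Real.one_le_rpow (by norm_num) (by positivity)
  rcases le_total (c * ρ) 1 with h | h
  · have h1 := evenExcess_scale A (s := c * ρ) (r := 1 / c) (by positivity) h (by positivity)
    rw [show c * ρ * (1 / c) = ρ by field_simp] at h1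
    have h2 := evenExcess_le_of_density (ρ := 1 / c) (by positivity)
      ((div_le_one hc0).2 hc) hc0.le hA
    rw [show 2 * c * (1 / c) = (2 : ℕ) by field_simp; norm_num, Real.rpow_natCast] at h2
    calc _ ≤ (c * ρ) ^ 2 * ((A.card : ℝ) ^ 2 * 2 ^ 2) := h1.trans (by gcongr)
      _ = (A.card : ℝ) ^ 2 * (4 * (c * ρ) ^ 2 * 1) := by ring
      _ ≤ _ := by gcongr
  · have h2 := evenExcess_le_of_density hρ0 hρ1 hc0.le hA
    rw [show 2 * c * ρ = 2 * (c * ρ) by ring, Real.rpow_mul (by norm_num)] at h2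
    refine h2.trans ?_
    have : (2 : ℝ) ^ (2 : ℝ) = 4 := by norm_num
    rw [this]
    have h3 : 1 ≤ 4 * (c * ρ) ^ 2 := by nlinarith
    exact mul_le_mul_of_nonneg_left (le_mul_of_one_le_left (by positivity) h3) (by positivity)

theorem exp_mul_sign {t e : ℝ} (he : e = 1 ∨ e = -1) :
    Real.exp (t * e) = Real.cosh t * (1 + Real.tanh t * e) := by
  rw [Real.tanh_eq_sinh_div_cosh]
  have := (Real.cosh_pos t).ne'
  have h1 := Real.cosh_add_sinh t
  have h2 := Real.cosh_sub_sinh t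
  rcases he with rfl | rfl
  · field_simp; simp
  · field_simp; simp [sub_eq_add_neg] at h2 ⊢; linarith

theorem chi_mul_chi_eq_one_or (a b : ZMod 2) : chi a * chi b = 1 ∨ chi a * chi b = -1 := by
  rcases chi_eq_one_or a with h | h <;> rcases chi_eq_one_or b with h' | h' <;> simp [h, h']

theorem exp_mul_signCorr {n : ℕ} (t : ℝ) (x y : Fin n → ZMod 2) :
    Real.exp (t * signCorr x y) =
      Real.cosh t ^ n * ∏ i, (1 + Real.tanh t * (chi (x i) * chi (y i))) := by
  rw [signCorr, Finset.mul_sum, Real.exp_sum]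
  simp_rw [fun i => exp_mul_sign (t := t) (chi_mul_chi_eq_one_or (x i) (y i))]
  simp [Finset.prod_mul_distrib]

/-- Symmetrizing in `t` removes the odd Fourier levels, which would contribute at first order
in `c * t`. -/
theorem sum_cosh_signCorr_le {n : ℕ} {A : Finset (Fin n → ZMod 2)} {c : ℝ} (hc : 1 ≤ c)
    (hA : (2 : ℝ) ^ n ≤ A.card * 2 ^ c) (t : ℝ) :
    ∑ x ∈ A, ∑ y ∈ A, Real.cosh (t * signCorr x y) ≤
      (A.card : ℝ) ^ 2 * (Real.exp (n * t ^ 2 / 2) * (1 + 4 * (c * t) ^ 2 * 4 ^ (c * |t|))) := by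
  wlog ht : 0 ≤ t generalizing t
  · have h := this (-t) (by linarith)
    simpa [Real.cosh_neg] using h
  have h1 : ∑ x ∈ A, ∑ y ∈ A, Real.cosh (t * signCorr x y) =
      Real.cosh t ^ n * ((A.card : ℝ) ^ 2 + evenExcess A (Real.tanh t)) := by
    rw [← half_sum_eq_evenExcess]
    simp_rw [fun x y => Real.cosh_eq (t * signCorr (n := n) x y), ← neg_mul,
      exp_mul_signCorr, Real.cosh_neg, Real.tanh_neg, ← Finset.sum_div, Finset.sum_add_distrib,
      ← Finset.mul_sum]
    ring
  have h0 := tanh_nonneg_of_nonneg ht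
  have hle := tanh_le_self_of_nonneg ht
  have h2 := evenExcess_le h0 (Real.tanh_lt_one t).le hc hA
  rw [h1, abs_of_nonneg ht]
  have h3 : Real.cosh t ^ n ≤ Real.exp (n * t ^ 2 / 2) := by
    calc _ ≤ Real.exp (t ^ 2 / 2) ^ n :=
          pow_le_pow_left₀ (Real.cosh_pos t).le (Real.cosh_le_exp_half_sq t) n
      _ = _ := by rw [← Real.exp_nat_mul]; congr 1; ring
  have h5 : (A.card : ℝ) ^ 2 * (4 * (c * Real.tanh t) ^ 2 * 4 ^ (c * Real.tanh t)) ≤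
      (A.card : ℝ) ^ 2 * (4 * (c * t) ^ 2 * 4 ^ (c * t)) := by
    have : (4 : ℝ) ^ (c * Real.tanh t) ≤ 4 ^ (c * t) :=
      Real.rpow_le_rpow_of_exponent_le (by norm_num) (by gcongr)
    gcongr
  have h6 := evenExcess_nonneg A h0
  calc _ ≤ Real.exp (n * t ^ 2 / 2) *
        ((A.card : ℝ) ^ 2 + (A.card : ℝ) ^ 2 * (4 * (c * t) ^ 2 * 4 ^ (c * t))) := by
        gcongr; exact h2.trans h5
    _ = _ := by ring

/-! ### Gaussian linearization and the mean-field Ising partition function -/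

theorem integrable_gaussian_mul_exp (s : ℝ) :
    Integrable fun g : ℝ => Real.exp (-(1 / 2) * g ^ 2) * Real.exp (s * g) := by
  have h := ((integrable_exp_neg_mul_sq (b := 1 / 2) (by norm_num)).comp_sub_right s).const_mul
    (Real.exp (s ^ 2 / 2))
  refine h.congr (Filter.Eventually.of_forall fun g => ?_)
  simp only [← Real.exp_add]
  congr 1; ring

theorem integral_gaussian_mul_exp (s : ℝ) :
    ∫ g : ℝ, Real.exp (-(1 / 2) * g ^ 2) * Real.exp (s * g) =
      √(2 * Real.pi) * Real.exp (s ^ 2 / 2) := by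
  have h : ∀ g : ℝ, Real.exp (-(1 / 2) * g ^ 2) * Real.exp (s * g) =
      Real.exp (s ^ 2 / 2) * Real.exp (-(1 / 2) * (g - s) ^ 2) := fun g => by
    simp only [← Real.exp_add]
    congr 1; ring
  simp_rw [h]
  rw [integral_const_mul, integral_sub_right_eq_self (fun g => Real.exp (-(1 / 2) * g ^ 2)) s,
    integral_gaussian, mul_comm, show Real.pi / (1 / 2) = 2 * Real.pi by ring]

theorem integrable_gaussian_mul_cosh (s : ℝ) :
    Integrable fun g : ℝ => Real.exp (-(1 / 2) * g ^ 2) * Real.cosh (s * g) := by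
  refine (((integrable_gaussian_mul_exp s).add (integrable_gaussian_mul_exp (-s))).div_const
    2).congr (Filter.Eventually.of_forall fun g => ?_)
  simp only [Pi.add_apply, Real.cosh_eq, neg_mul]
  ring

/-- The Gaussian linearization (Hubbard–Stratonovich) of `exp (s ^ 2 / 2)`. -/
theorem integral_gaussian_mul_cosh (s : ℝ) :
    ∫ g : ℝ, Real.exp (-(1 / 2) * g ^ 2) * Real.cosh (s * g) =
      √(2 * Real.pi) * Real.exp (s ^ 2 / 2) := by
  have h : ∀ g : ℝ, Real.exp (-(1 / 2) * g ^ 2) * Real.cosh (s * g) =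
      (Real.exp (-(1 / 2) * g ^ 2) * Real.exp (s * g) +
        Real.exp (-(1 / 2) * g ^ 2) * Real.exp (-s * g)) / 2 := fun g => by
    rw [Real.cosh_eq, neg_mul s]; ring
  simp_rw [h]
  rw [integral_div, integral_add (integrable_gaussian_mul_exp s) (integrable_gaussian_mul_exp (-s)),
    integral_gaussian_mul_exp, integral_gaussian_mul_exp, neg_sq]
  ring

/-- A crude domination by a Gaussian of smaller weight, which makes the error term integrable. -/
theorem sq_mul_rpow_abs_le (g : ℝ) :
    g ^ 2 * 4 ^ |g| ≤ 8 * Real.exp 8 * Real.exp (g ^ 2 / 4) := by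
  have h1 : g ^ 2 ≤ 8 * Real.exp (g ^ 2 / 8) := by
    linarith [Real.add_one_le_exp (g ^ 2 / 8)]
  have h2 : (4 : ℝ) ^ |g| ≤ Real.exp (8 + g ^ 2 / 8) := by
    have h4 : (4 : ℝ) ≤ Real.exp 2 := by
      have := Real.exp_one_gt_d9
      rw [show (2 : ℝ) = 1 + 1 by norm_num, Real.exp_add]
      nlinarith
    calc (4 : ℝ) ^ |g| ≤ Real.exp 2 ^ |g| := by gcongr
      _ = Real.exp (2 * |g|) := by rw [← Real.exp_mul]
      _ ≤ _ := by
        apply Real.exp_le_exp.2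
        nlinarith [sq_nonneg (|g| - 8), sq_abs g]
  calc _ ≤ (8 * Real.exp (g ^ 2 / 8)) * Real.exp (8 + g ^ 2 / 8) := by gcongr
    _ = 8 * (Real.exp (g ^ 2 / 8) * Real.exp (8 + g ^ 2 / 8)) := by ring
    _ = 8 * (Real.exp 8 * Real.exp (g ^ 2 / 4)) := by
      rw [← Real.exp_add, ← Real.exp_add]; ring_nf
    _ = _ := by ring

/-- The exponential moment of the squared correlation of two uniform points of a dense set: the main
term is the Gaussian one, the error comes from the Fourier levels from two on. -/
theorem sum_exp_signCorr_sq_le {n : ℕ} {A : Finset (Fin n → ZMod 2)} {c p α : ℝ} (hc : 1 ≤ c)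
    (hA : (2 : ℝ) ^ n ≤ A.card * 2 ^ c) (hp : 0 ≤ p) (hα : n * p = α)
    (hα4 : α ≤ 1 / 4) (hcp : c * √p ≤ 1) :
    ∑ x ∈ A, ∑ y ∈ A, Real.exp (p * signCorr x y ^ 2 / 2) ≤
      (A.card : ℝ) ^ 2 * ((√(1 - α))⁻¹ + 64 * Real.exp 8 * (c ^ 2 * p)) := by
  have hπ : 0 < √(2 * Real.pi) := Real.sqrt_pos.2 (by positivity)
  have hsq : √p ^ 2 = p := Real.sq_sqrt hp
  set K := 32 * Real.exp 8 * (c ^ 2 * p) with hK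
  have e1 : √(2 * Real.pi) * ∑ x ∈ A, ∑ y ∈ A, Real.exp (p * signCorr x y ^ 2 / 2) =
      ∫ g : ℝ, ∑ x ∈ A, ∑ y ∈ A,
        Real.exp (-(1 / 2) * g ^ 2) * Real.cosh (√p * signCorr x y * g) := by
    rw [integral_finsetSum _ fun x _ => integrable_finsetSum _ fun y _ =>
      integrable_gaussian_mul_cosh _, Finset.mul_sum]
    refine Finset.sum_congr rfl fun x _ => ?_
    rw [integral_finsetSum _ fun y _ => integrable_gaussian_mul_cosh _, Finset.mul_sum]
    refine Finset.sum_congr rfl fun y _ => ?_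
    rw [integral_gaussian_mul_cosh, mul_pow, hsq]
  have hi1 : Integrable fun g : ℝ => Real.exp (-((1 - α) / 2) * g ^ 2) :=
    integrable_exp_neg_mul_sq (by linarith)
  have hi2 : Integrable fun g : ℝ => Real.exp (-(1 / 8) * g ^ 2) :=
    integrable_exp_neg_mul_sq (by norm_num)
  have e2 : ∫ g : ℝ, ∑ x ∈ A, ∑ y ∈ A,
        Real.exp (-(1 / 2) * g ^ 2) * Real.cosh (√p * signCorr x y * g) ≤
      ∫ g : ℝ, (A.card : ℝ) ^ 2 *
        (Real.exp (-((1 - α) / 2) * g ^ 2) + K * Real.exp (-(1 / 8) * g ^ 2)) := by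
    apply integral_mono
    · exact integrable_finsetSum _ fun x _ => integrable_finsetSum _ fun y _ =>
        integrable_gaussian_mul_cosh _
    · exact (hi1.add (hi2.const_mul K)).const_mul _
    intro g
    have h := sum_cosh_signCorr_le hc hA (√p * g)
    simp only [mul_right_comm (√p) _ g, ← Finset.mul_sum]
    have h4 : (4 : ℝ) ^ (c * |√p * g|) ≤ 4 ^ |g| := by
      apply Real.rpow_le_rpow_of_exponent_le (by norm_num)
      rw [abs_mul, abs_of_nonneg (Real.sqrt_nonneg p), ← mul_assoc]
      exact mul_le_of_le_one_left (abs_nonneg g) hcp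
    have h5 : n * (√p * g) ^ 2 / 2 = α * g ^ 2 / 2 := by
      rw [mul_pow, hsq, ← hα]; ring
    have h6 : 4 * (c * (√p * g)) ^ 2 * 4 ^ (c * |√p * g|) ≤ K * Real.exp (g ^ 2 / 4) := by
      calc 4 * (c * (√p * g)) ^ 2 * 4 ^ (c * |√p * g|)
          = 4 * (c ^ 2 * p) * (g ^ 2 * 4 ^ (c * |√p * g|)) := by
            rw [mul_pow, mul_pow, hsq]; ring
        _ ≤ 4 * (c ^ 2 * p) * (8 * Real.exp 8 * Real.exp (g ^ 2 / 4)) := by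
            exact mul_le_mul_of_nonneg_left ((mul_le_mul_of_nonneg_left h4 (sq_nonneg g)).trans
              (sq_mul_rpow_abs_le g)) (by positivity)
        _ = _ := by rw [hK]; ring
    have hK0 : 0 ≤ K := by positivity
    rw [h5] at h
    calc _ ≤ Real.exp (-(1 / 2) * g ^ 2) * ((A.card : ℝ) ^ 2 *
          (Real.exp (α * g ^ 2 / 2) * (1 + K * Real.exp (g ^ 2 / 4)))) := by
          refine mul_le_mul_of_nonneg_left (h.trans ?_) (Real.exp_pos _).le
          gcongr
      _ = (A.card : ℝ) ^ 2 * (Real.exp (-(1 / 2) * g ^ 2) * Real.exp (α * g ^ 2 / 2) +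
          K * (Real.exp (-(1 / 2) * g ^ 2) * Real.exp (α * g ^ 2 / 2) * Real.exp (g ^ 2 / 4))) := by
          ring
      _ ≤ _ := by
          simp only [← Real.exp_add]
          refine mul_le_mul_of_nonneg_left (add_le_add (Real.exp_le_exp.2 ?_)
            (mul_le_mul_of_nonneg_left (Real.exp_le_exp.2 ?_) hK0)) (by positivity)
          · apply le_of_eq; ring
          · nlinarith [sq_nonneg g]
  have e3 : ∫ g : ℝ, (A.card : ℝ) ^ 2 *
        (Real.exp (-((1 - α) / 2) * g ^ 2) + K * Real.exp (-(1 / 8) * g ^ 2)) =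
      √(2 * Real.pi) * ((A.card : ℝ) ^ 2 * ((√(1 - α))⁻¹ + 2 * K)) := by
    rw [integral_const_mul, integral_add hi1 (hi2.const_mul K), integral_const_mul,
      integral_gaussian, integral_gaussian,
      show Real.pi / ((1 - α) / 2) = 2 * Real.pi / (1 - α) by rw [div_div_eq_mul_div]; ring,
      show Real.pi / (1 / 8) = 2 * Real.pi * 2 ^ 2 by ring,
      Real.sqrt_div (by positivity), Real.sqrt_mul (x := 2 * Real.pi) (by positivity),
      Real.sqrt_sq (by norm_num)]
    ring
  have := e1.trans_le (e2.trans_eq e3)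
  refine (le_of_mul_le_mul_left this hπ).trans_eq ?_
  rw [hK]; ring

theorem log_one_add_le {z : ℝ} (hz : |z| ≤ 1 / 2) :
    |Real.log (1 + z) - (z - z ^ 2 / 2)| ≤ 2 * |z| ^ 3 := by
  have h := Real.abs_log_sub_add_sum_range_le (x := -z) (by rw [abs_neg]; linarith) 2
  simp only [Finset.sum_range_succ, Finset.sum_range_zero, abs_neg, sub_neg_eq_add] at h
  have h2 : |z| ^ (2 + 1) / (1 - |z|) ≤ 2 * |z| ^ 3 := by
    rw [div_le_iff₀ (by linarith)]
    have h3 : 0 ≤ |z| ^ 3 * (1 - 2 * |z|) :=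
      mul_nonneg (pow_nonneg (abs_nonneg z) 3) (by linarith)
    calc |z| ^ (2 + 1) ≤ |z| ^ (2 + 1) + |z| ^ 3 * (1 - 2 * |z|) := by linarith
      _ = _ := by ring
  refine le_trans (le_of_eq ?_) (h.trans h2)
  congr 1
  push_cast; ring

theorem one_add_le_exp {z : ℝ} (hz : |z| ≤ 1 / 2) :
    1 + z ≤ Real.exp (z - z ^ 2 / 2 + 2 * |z| ^ 3) := by
  have h0 := abs_le.1 hz
  rw [← Real.log_le_iff_le_exp (by linarith [h0.1])]
  linarith [(abs_le.1 (log_one_add_le hz)).2]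

theorem inv_sqrt_one_sub_le {α : ℝ} (h0 : 0 ≤ α) (h1 : α ≤ 1 / 2) :
    (√(1 - α))⁻¹ ≤ Real.exp (α / 2 + α ^ 2 / 4 + α ^ 3) := by
  have h := (abs_le.1 (log_one_add_le (z := -α) (by rwa [abs_neg, abs_of_nonneg h0]))).1
  rw [abs_neg, abs_of_nonneg h0, ← sub_eq_add_neg] at h
  rw [← Real.log_le_iff_le_exp (inv_pos.2 (Real.sqrt_pos.2 (by linarith))), Real.log_inv,
    Real.log_sqrt (by linarith)]
  linarith

/-- The finite set of potential edges on `n` vertices. -/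
def potentialEdges (n : ℕ) : Finset (Sym2 (Fin n)) := {e | ¬ e.IsDiag}

theorem sum_sq_eq_sum_potentialEdges {n : ℕ} (z : Fin n → ℝ) :
    (∑ i, z i) ^ 2 = ∑ i, z i ^ 2 + 2 * ∑ e ∈ potentialEdges n, (e.map z).mul := by
  have h := Finset.sum_sym2_filter_not_isDiag (Finset.univ : Finset (Fin n))
    (fun e => (e.map z).mul)
  rw [Finset.sym2_univ] at h
  rw [potentialEdges, h]
  simp only [Sym2.map_mk, Sym2.mul_mk]
  have hd : ∑ i ∈ (Finset.univ : Finset (Fin n)).offDiag, z i.1 * z i.2 =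
      2 * ∑ i ∈ (Finset.univ : Finset (Fin n)).offDiag with i.1 < i.2, z i.1 * z i.2 := by
    rw [← Finset.sum_filter_add_sum_filter_not _ (fun i : Fin n × Fin n => i.1 < i.2), two_mul]
    congr 1
    refine Finset.sum_nbij' Prod.swap Prod.swap ?_ ?_ ?_ ?_ ?_
    · intro i hi
      simp only [Finset.mem_filter, Finset.mem_offDiag, Finset.mem_univ, true_and,
        Prod.fst_swap, Prod.snd_swap] at hi ⊢
      exact ⟨Ne.symm hi.1, lt_of_le_of_ne (not_lt.1 hi.2) (Ne.symm hi.1)⟩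
    · intro i hi
      simp only [Finset.mem_filter, Finset.mem_offDiag, Finset.mem_univ, true_and,
        Prod.fst_swap, Prod.snd_swap] at hi ⊢
      exact ⟨Ne.symm hi.1, not_lt.2 hi.2.le⟩
    · simp
    · simp
    · intro i _; exact mul_comm _ _
  rw [← hd, sq, Finset.sum_mul_sum, ← Finset.sum_product', ← Finset.diag_union_offDiag,
    Finset.sum_union (Finset.disjoint_diag_offDiag _), Finset.sum_diag]
  simp [sq]

theorem card_potentialEdges (n : ℕ) : 2 * ((potentialEdges n).card : ℝ) = n ^ 2 - n := by
  have h := sum_sq_eq_sum_potentialEdges (n := n) (fun _ => 1)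
  have h1 : ∀ e : Sym2 (Fin n), (e.map fun _ => (1 : ℝ)).mul = 1 := fun e => by
    induction e with | _ u v => simp
  simp only [h1] at h
  simp at h
  linarith

/-- The sign `σ u * σ v` of a potential edge `s(u, v)`, where `σ i = (-1) ^ (x i + y i)`. -/
noncomputable def edgeSign {n : ℕ} (x y : Fin n → ZMod 2) (e : Sym2 (Fin n)) : ℝ :=
  (e.map fun i => chi (x i) * chi (y i)).mul

theorem edgeSign_eq_one_or {n : ℕ} (x y : Fin n → ZMod 2) (e : Sym2 (Fin n)) :
    edgeSign x y e = 1 ∨ edgeSign x y e = -1 := by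
  induction e with
  | _ u v =>
    simp only [edgeSign, Sym2.map_mk, Sym2.mul_mk]
    rcases chi_mul_chi_eq_one_or (x u) (y u) with h | h <;>
      rcases chi_mul_chi_eq_one_or (x v) (y v) with h' | h' <;> simp [h, h']

theorem sum_edgeSign {n : ℕ} (x y : Fin n → ZMod 2) :
    ∑ e ∈ potentialEdges n, edgeSign x y e = (signCorr x y ^ 2 - n) / 2 := by
  rw [signCorr, sum_sq_eq_sum_potentialEdges]
  have : ∀ i, (chi (x i) * chi (y i)) ^ 2 = 1 := fun i => by
    rcases chi_mul_chi_eq_one_or (x i) (y i) with h | h <;> simp [h]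
  simp [this, edgeSign]

/-- The Ising partition function weight in terms of the magnetization `signCorr x y`. The second
order term `-p ^ 2 / 4` has to be kept: it cancels a term of order `α ^ 2` later. -/
theorem prod_one_add_edgeSign_le {n : ℕ} {p : ℝ} (hp0 : 0 ≤ p) (hp : p ≤ 1 / 2)
    (x y : Fin n → ZMod 2) :
    ∏ e ∈ potentialEdges n, (1 + p * edgeSign x y e) ≤
      Real.exp (-(n * p / 2) - (n ^ 2 - n) * (p ^ 2 / 4 - p ^ 3)) *
        Real.exp (p * signCorr x y ^ 2 / 2) := by
  have hterm : ∀ e, 1 + p * edgeSign x y e ≤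
      Real.exp (p * edgeSign x y e - p ^ 2 / 2 + 2 * p ^ 3) := fun e => by
    have habs : |p * edgeSign x y e| = p := by
      rcases edgeSign_eq_one_or x y e with h | h <;> simp [h, abs_of_nonneg hp0]
    have hsq : (p * edgeSign x y e) ^ 2 = p ^ 2 := by rw [← sq_abs, habs]
    have := one_add_le_exp (z := p * edgeSign x y e) (by rwa [habs])
    rwa [hsq, habs] at this
  calc _ ≤ ∏ e ∈ potentialEdges n, Real.exp (p * edgeSign x y e - p ^ 2 / 2 + 2 * p ^ 3) := by
        refine Finset.prod_le_prod (fun e _ => ?_) fun e _ => hterm e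
        rcases edgeSign_eq_one_or x y e with h | h <;> rw [h] <;> linarith
    _ = _ := by
      rw [← Real.exp_sum, ← Real.exp_add]
      congr 1
      rw [Finset.sum_add_distrib, Finset.sum_sub_distrib, ← Finset.mul_sum, sum_edgeSign]
      simp only [Finset.sum_const, nsmul_eq_mul]
      linear_combination (-p ^ 2 / 4 + p ^ 3) * card_potentialEdges n

theorem exp_le_one_add_two_mul {x : ℝ} (h0 : 0 ≤ x) (h1 : x ≤ 1 / 2) :
    Real.exp x ≤ 1 + 2 * x := by
  have h := Real.exp_bound_div_one_sub_of_interval h0 (by linarith)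
  refine h.trans ?_
  rw [div_le_iff₀ (by linarith)]
  nlinarith

/-- The Ising partition function summed over pairs of points of a dense set. The terms of order `α`
and `α ^ 2` of the prefactor `D` and of the Gaussian moment `(1 - α) ^ (-1/2)` cancel. -/
theorem sum_prod_one_add_edgeSign_le {n : ℕ} {A : Finset (Fin n → ZMod 2)} {c p α : ℝ}
    (hc : 1 ≤ c) (hA : (2 : ℝ) ^ n ≤ A.card * 2 ^ c) (hn : 1 ≤ n * α) (hα : n * p = α)
    (hα0 : 0 < α) (hα1 : α ≤ 1 / 16) (hcp : c * √p ≤ 1) :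
    ∑ x ∈ A, ∑ y ∈ A, ∏ e ∈ potentialEdges n, (1 + p * edgeSign x y e) ≤
      (A.card : ℝ) ^ 2 * (1 + (6 * α ^ 3 + 64 * Real.exp 8 * (c ^ 2 * p))) := by
  have hn0 : 0 < (n : ℝ) := by
    by_contra h
    have : (n : ℝ) = 0 := le_antisymm (not_lt.1 h) (Nat.cast_nonneg n)
    simp [this] at hn; linarith
  have hn1 : 1 ≤ (n : ℝ) := by exact_mod_cast Nat.one_le_iff_ne_zero.2 (by
    rintro rfl; simp at hn0)
  have hp0 : 0 ≤ p := by
    by_contra h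
    nlinarith
  have hpα : p ≤ α := by nlinarith
  set D := Real.exp (-(n * p / 2) - (n ^ 2 - n) * (p ^ 2 / 4 - p ^ 3)) with hD
  have hD1 : D ≤ Real.exp (-(α / 2) - α ^ 2 / 4 + 2 * α ^ 3) := by
    apply Real.exp_le_exp.2
    have a1 : (n : ℝ) ^ 2 * p ^ 2 = α ^ 2 := by rw [← hα]; ring
    have a2 : (n : ℝ) * p ^ 2 ≤ α ^ 3 := by
      have : (n : ℝ) * p ^ 2 = α * p := by rw [← hα]; ring
      have h2 : p ≤ α ^ 2 := by
        have : p * 1 ≤ p * (n * α) := by gcongr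
        nlinarith
      rw [this]; nlinarith
    have a3 : (n : ℝ) ^ 2 * p ^ 3 ≤ α ^ 3 := by
      have : (n : ℝ) ^ 2 * p ^ 3 = α ^ 2 * p := by rw [← hα]; ring
      rw [this]; nlinarith [mul_le_mul_of_nonneg_left hpα (sq_nonneg α)]
    have a4 : 0 ≤ (n : ℝ) * p ^ 3 := by positivity
    have a5 : 0 ≤ (n : ℝ) * p ^ 2 := by positivity
    rw [hα]
    nlinarith [pow_pos hα0 3]
  have hα3 : α ^ 3 ≤ α / 256 := by nlinarith [sq_nonneg α]
  have hD2 : D ≤ 1 := by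
    refine hD1.trans (Real.exp_le_one_iff.2 ?_)
    nlinarith [sq_nonneg α]
  have hD3 : D * (√(1 - α))⁻¹ ≤ 1 + 6 * α ^ 3 := by
    calc _ ≤ Real.exp (-(α / 2) - α ^ 2 / 4 + 2 * α ^ 3) *
          Real.exp (α / 2 + α ^ 2 / 4 + α ^ 3) := by
          gcongr
          exact inv_sqrt_one_sub_le hα0.le (by linarith)
      _ = Real.exp (3 * α ^ 3) := by rw [← Real.exp_add]; ring_nf
      _ ≤ 1 + 2 * (3 * α ^ 3) := exp_le_one_add_two_mul (by positivity) (by linarith)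
      _ = _ := by ring
  calc _ ≤ ∑ x ∈ A, ∑ y ∈ A, D * Real.exp (p * signCorr x y ^ 2 / 2) := by
        gcongr with x _ y _
        exact prod_one_add_edgeSign_le hp0 (by linarith) x y
    _ = D * ∑ x ∈ A, ∑ y ∈ A, Real.exp (p * signCorr x y ^ 2 / 2) := by
        simp only [Finset.mul_sum]
    _ ≤ D * ((A.card : ℝ) ^ 2 * ((√(1 - α))⁻¹ + 64 * Real.exp 8 * (c ^ 2 * p))) := by
        gcongr
        exact sum_exp_signCorr_sq_le hc hA hp0 hα (by linarith) hcp
    _ = (A.card : ℝ) ^ 2 * (D * (√(1 - α))⁻¹ + D * (64 * Real.exp 8 * (c ^ 2 * p))) := by ring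
    _ ≤ (A.card : ℝ) ^ 2 * (1 + 6 * α ^ 3 + 1 * (64 * Real.exp 8 * (c ^ 2 * p))) := by
        gcongr
    _ = _ := by ring

/-! ### Collisions, and averaging over the binomial random graph -/

open Classical in
/-- If `x` is uniform in `A`, the probability that a test `B` accepts `h x` differs from its
acceptance probability on a uniform input by at most the square root of the normalized collision
excess (Cauchy–Schwarz). -/
theorem sq_hit_sub_le_collision {X W : Type*} [Fintype W] (A : Finset X) (hA : A.Nonempty)
    (h : X → W) (B : W → Bool) :
    (((A.filter fun x => B (h x) = true).card : ℝ) / A.card -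
        ((Finset.univ.filter fun w => B w = true).card : ℝ) / Fintype.card W) ^ 2 ≤
      (∑ x ∈ A, ∑ y ∈ A, if h x = h y then (Fintype.card W : ℝ) else 0) / (A.card : ℝ) ^ 2 - 1 := by
  obtain ⟨x₀, hx₀⟩ := hA
  have hAc : (0 : ℝ) < A.card := by exact_mod_cast Finset.card_pos.2 ⟨x₀, hx₀⟩
  have : Nonempty W := ⟨h x₀⟩
  have hN : (0 : ℝ) < Fintype.card W := by exact_mod_cast Fintype.card_pos
  set N : ℝ := (Fintype.card W : ℝ)
  set a : ℝ := (A.card : ℝ)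
  -- the law of `h x`
  set q : W → ℝ := fun w => ((A.filter fun x => h x = w).card : ℝ) / a with hq
  set S := Finset.univ.filter fun w => B w = true
  have hsum : ∀ T : Finset W, ∑ w ∈ T, q w = ((A.filter fun x => h x ∈ T).card : ℝ) / a := by
    intro T
    rw [hq, ← Finset.sum_div]
    congr 1
    rw [Finset.card_eq_sum_card_fiberwise (f := h) (s := A.filter fun x => h x ∈ T) (t := T)
      (fun x hx => (Finset.mem_filter.1 hx).2)]
    push_cast
    refine Finset.sum_congr rfl fun w hw => ?_
    rw [Finset.filter_filter]
    congr 2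
    ext x
    simp only [Finset.mem_filter]
    constructor
    · rintro ⟨h1, rfl⟩; exact ⟨h1, hw, rfl⟩
    · rintro ⟨h1, _, h2⟩; exact ⟨h1, h2⟩
  have hq1 : ∑ w, q w = 1 := by
    rw [hsum]
    simp only [Finset.mem_univ, Finset.filter_true]
    exact div_self hAc.ne'
  have hqS : ((A.filter fun x => B (h x) = true).card : ℝ) / a = ∑ w ∈ S, q w := by
    rw [hsum]; simp [S]
  have hqq : ∑ w, q w ^ 2 = (∑ x ∈ A, ∑ y ∈ A, if h x = h y then (1 : ℝ) else 0) / a ^ 2 := by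
    have : ∀ w, q w ^ 2 = (∑ x ∈ A, ∑ y ∈ A, if h x = w ∧ h y = w then (1 : ℝ) else 0) / a ^ 2 := by
      intro w
      rw [hq]
      simp only [div_pow]
      congr 1
      simp only [Finset.card_filter, Nat.cast_sum, sq, Finset.sum_mul_sum, ite_and]
      refine Finset.sum_congr rfl fun x _ => Finset.sum_congr rfl fun y _ => ?_
      split_ifs <;> simp
    simp only [this]
    rw [← Finset.sum_div, Finset.sum_comm]
    congr 1
    refine Finset.sum_congr rfl fun x _ => ?_
    rw [Finset.sum_comm]
    refine Finset.sum_congr rfl fun y _ => ?_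
    by_cases hxy : h x = h y
    · simp [hxy]
    · rw [if_neg hxy]
      refine Finset.sum_eq_zero fun w _ => if_neg ?_
      rintro ⟨rfl, h2⟩
      exact hxy h2.symm
  have hcs := Finset.sum_mul_sq_le_sq_mul_sq S (fun _ => (1 : ℝ)) (fun w => q w - 1 / N)
  have hd : ((A.filter fun x => B (h x) = true).card : ℝ) / a - (S.card : ℝ) / N =
      ∑ w ∈ S, 1 * (q w - 1 / N) := by
    simp only [one_mul]
    rw [hqS, Finset.sum_sub_distrib, Finset.sum_const, nsmul_eq_mul]
    ring
  rw [hd]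
  refine hcs.trans ?_
  have h1 : ∑ w ∈ S, (1 : ℝ) ^ 2 ≤ N := by
    simp only [one_pow, Finset.sum_const, nsmul_eq_mul, mul_one]
    exact Nat.cast_le.2 (Finset.card_le_univ S)
  have h2 : ∑ w ∈ S, (q w - 1 / N) ^ 2 ≤ ∑ w, (q w - 1 / N) ^ 2 :=
    Finset.sum_le_sum_of_subset_of_nonneg (Finset.subset_univ _) fun _ _ _ => sq_nonneg _
  have h3 : ∑ w, (q w - 1 / N) ^ 2 = ∑ w, q w ^ 2 - 1 / N := by
    have : ∀ w, (q w - 1 / N) ^ 2 = q w ^ 2 - 2 / N * q w + (1 / N) ^ 2 := fun w => by ring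
    simp only [this]
    rw [Finset.sum_add_distrib, Finset.sum_sub_distrib, ← Finset.mul_sum, hq1, Finset.sum_const,
      nsmul_eq_mul, Finset.card_univ]
    change _ - 2 / N * 1 + N * (1 / N) ^ 2 = _
    field_simp
    ring
  have h4 : (∑ x ∈ A, ∑ y ∈ A, if h x = h y then N else 0) =
      N * ∑ x ∈ A, ∑ y ∈ A, if h x = h y then (1 : ℝ) else 0 := by
    simp only [Finset.mul_sum, mul_ite, mul_one, mul_zero]
  calc _ ≤ N * (∑ w, q w ^ 2 - 1 / N) := by
        rw [← h3]
        exact mul_le_mul h1 h2 (Finset.sum_nonneg fun _ _ => sq_nonneg _) hN.le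
    _ = _ := by
        rw [hqq, h4]; field_simp

theorem zmod_two_eq_zero_or_one : ∀ a : ZMod 2, a = 0 ∨ a = 1 := by decide

theorem chi_add (a b : ZMod 2) : chi (a + b) = chi a * chi b := by
  have h2 : (1 : ZMod 2) + 1 = 0 := by decide
  rcases zmod_two_eq_zero_or_one a with rfl | rfl <;>
    rcases zmod_two_eq_zero_or_one b with rfl | rfl <;> simp [h2]

theorem one_add_chi_mul_chi (a b : ZMod 2) :
    1 + chi a * chi b = if a = b then 2 else 0 := by
  rcases zmod_two_eq_zero_or_one a with rfl | rfl <;>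
    rcases zmod_two_eq_zero_or_one b with rfl | rfl <;> norm_num

theorem edgeIncidence_mulVec {n : ℕ} (G : SimpleGraph (Fin n)) (x : Fin n → ZMod 2)
    (e : G.edgeSet) {u v : Fin n} (he : (e : Sym2 (Fin n)) = s(u, v)) :
    (edgeIncidence G *ᵥ x) e = x u + x v := by
  have huv : u ≠ v := by
    have := e.2
    rw [he, SimpleGraph.mem_edgeSet] at this
    exact this.ne
  simp only [edgeIncidence, Matrix.mulVec, dotProduct, Matrix.of_apply, he, Sym2.mem_iff,
    ite_mul, one_mul, zero_mul]
  rw [← Finset.sum_filter]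
  have : (Finset.univ.filter fun i => i = u ∨ i = v) = {u, v} := by ext; simp
  rw [this, Finset.sum_pair huv]

theorem edgeSign_eq_chi {n : ℕ} (G : SimpleGraph (Fin n)) (x y : Fin n → ZMod 2)
    (e : G.edgeSet) :
    edgeSign x y e = chi ((edgeIncidence G *ᵥ x) e) * chi ((edgeIncidence G *ᵥ y) e) := by
  obtain ⟨⟨u, v⟩, he⟩ : ∃ q : Fin n × Fin n, (e : Sym2 (Fin n)) = s(q.1, q.2) := by
    induction h : (e : Sym2 (Fin n)) with | _ u v => exact ⟨(u, v), rfl⟩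
  rw [edgeIncidence_mulVec G x e he, edgeIncidence_mulVec G y e he, chi_add, chi_add, he]
  simp only [edgeSign, Sym2.map_mk, Sym2.mul_mk]
  ring

open Classical in
/-- The product over the edges of `1 + edgeSign` is `2 ^ |E(G)|` times the collision indicator. -/
theorem prod_edges_one_add_edgeSign {n : ℕ} (G : SimpleGraph (Fin n)) (x y : Fin n → ZMod 2) :
    ∏ e ∈ G.edgeFinset, (1 + edgeSign x y e) =
      if edgeIncidence G *ᵥ x = edgeIncidence G *ᵥ y then
        (Fintype.card (G.edgeSet → ZMod 2) : ℝ) else 0 := by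
  rw [← Finset.prod_coe_sort G.edgeFinset fun e => 1 + edgeSign x y e]
  have h : ∏ e : G.edgeFinset, (1 + edgeSign x y e) = ∏ e : G.edgeSet, (1 + edgeSign x y e) :=
    Fintype.prod_equiv (Equiv.subtypeEquivRight fun e => by simp) _ _ fun e => rfl
  rw [h]
  simp_rw [edgeSign_eq_chi, one_add_chi_mul_chi]
  split_ifs with hxy
  · simp [hxy, ZMod.card]
  · obtain ⟨e, he⟩ := Function.ne_iff.1 hxy
    exact Finset.prod_eq_zero (Finset.mem_univ e) (if_neg he)

open Classical in
theorem toReal_binomialRandom_toPMF {n : ℕ} (p : unitInterval) (G : SimpleGraph (Fin n)) :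
    ((SimpleGraph.binomialRandom (Fin n) p).toPMF G).toReal =
      (p : ℝ) ^ G.edgeFinset.card * (1 - p) ^ (potentialEdges n \ G.edgeFinset).card := by
  have hsub : G.edgeFinset ⊆ potentialEdges n := fun e he => by
    simp only [potentialEdges, Finset.mem_filter, Finset.mem_univ, true_and]
    exact G.not_isDiag_of_mem_edgeSet (by simpa using he)
  have hc : ((n.choose 2 : ℕ)) = (potentialEdges n).card := by
    have h1 := card_potentialEdges n
    have h2 : ((n.choose 2 : ℕ) : ℝ) = (potentialEdges n).card := by
      rw [Nat.cast_choose_two]; linarith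
    exact_mod_cast h2
  rw [Measure.toPMF_apply, SimpleGraph.binomialRandom_singleton, Finset.card_sdiff_of_subset hsub,
    ← hc, Nat.card_eq_fintype_card, Fintype.card_fin, ← SimpleGraph.coe_edgeFinset,
    Set.ncard_coe_finset]
  simp

open Classical in
/-- Independence of the edges: averaging over the binomial random graph. -/
theorem sum_binomialRandom_mul_prod {n : ℕ} (p : unitInterval) (f : Sym2 (Fin n) → ℝ) :
    ∑ G : SimpleGraph (Fin n), ((SimpleGraph.binomialRandom (Fin n) p).toPMF G).toReal *
        ∏ e ∈ G.edgeFinset, (1 + f e) =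
      ∏ e ∈ potentialEdges n, (1 + p * f e) := by
  have h : ∀ e, 1 + (p : ℝ) * f e = p * (1 + f e) + (1 - p) := fun e => by ring
  simp_rw [toReal_binomialRandom_toPMF]
  rw [Finset.prod_congr rfl fun e _ => h e, Finset.prod_add]
  refine Finset.sum_bij' (fun G _ => G.edgeFinset)
    (fun T _ => SimpleGraph.fromEdgeSet (T : Set (Sym2 (Fin n)))) ?_ ?_ ?_ ?_ ?_
  · intro G _
    rw [Finset.mem_powerset]
    intro e he
    simp only [potentialEdges, Finset.mem_filter, Finset.mem_univ, true_and]
    exact G.not_isDiag_of_mem_edgeSet (by simpa using he)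
  · intro T _; exact Finset.mem_univ _
  · intro G _; simp
  · intro T hT
    rw [Finset.mem_powerset] at hT
    ext e
    simp only [SimpleGraph.mem_edgeFinset, SimpleGraph.edgeSet_fromEdgeSet, Set.mem_sdiff,
      Finset.mem_coe]
    constructor
    · exact fun h => h.1
    · intro h
      refine ⟨h, ?_⟩
      have := hT h
      simpa [potentialEdges] using this
  · intro G _
    simp only [Finset.prod_mul_distrib, Finset.prod_const]
    ring

theorem sum_toReal_eq_one {β : Type*} [Fintype β] (q : PMF β) : ∑ b, (q b).toReal = 1 := by
  rw [← ENNReal.toReal_sum fun b _ => q.apply_ne_top b, ← tsum_fintype (L := .unconditional _),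
    q.tsum_coe, ENNReal.toReal_one]

open Classical in
/-- If Alice's vector is uniform in a set `A` of density at least `2 ^ (-c)`, then on average over
the random graph no test by Bob distinguishes `M x` from a uniform vector well. -/
theorem sum_binomialRandom_mul_advantage_le {n : ℕ} {A : Finset (Fin n → ZMod 2)} {c α : ℝ}
    {p : unitInterval} (hc : 1 ≤ c) (hA : (2 : ℝ) ^ n ≤ A.card * 2 ^ c) (hn : 1 ≤ n * α)
    (hα : n * (p : ℝ) = α) (hα0 : 0 < α) (hα1 : α ≤ 1 / 16) (hcp : c * √(p : ℝ) ≤ 1)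
    (B : (G : SimpleGraph (Fin n)) → (G.edgeSet → ZMod 2) → Bool) :
    ∑ G : SimpleGraph (Fin n), ((SimpleGraph.binomialRandom (Fin n) p).toPMF G).toReal *
        (((A.filter fun x => B G (edgeIncidence G *ᵥ x) = true).card : ℝ) / A.card -
          ((Finset.univ.filter fun w => B G w = true).card : ℝ) /
            Fintype.card (G.edgeSet → ZMod 2)) ≤
      √(6 * α ^ 3 + 64 * Real.exp 8 * (c ^ 2 * p)) := by
  have hApos : 0 < (A.card : ℝ) := by
    have : (0 : ℝ) < A.card * 2 ^ c := lt_of_lt_of_le (by positivity) hA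
    exact pos_of_mul_pos_left this (by positivity)
  have hAne : A.Nonempty := Finset.card_pos.1 (by exact_mod_cast hApos)
  set P : SimpleGraph (Fin n) → ℝ :=
    fun G => ((SimpleGraph.binomialRandom (Fin n) p).toPMF G).toReal with hP
  have hP1 : ∑ G, P G = 1 := sum_toReal_eq_one _
  have hP0 : ∀ G, 0 ≤ P G := fun G => ENNReal.toReal_nonneg
  apply Real.le_sqrt_of_sq_le
  -- Jensen's inequality moves the square inside the average over `G`
  refine ((even_two.convexOn_pow (𝕜 := ℝ)).map_sum_le (t := Finset.univ) (w := P)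
    (fun G _ => hP0 G) hP1 (fun G _ => Set.mem_univ _)).trans ?_
  simp only [smul_eq_mul]
  calc _ ≤ ∑ G, P G * ((∑ x ∈ A, ∑ y ∈ A, ∏ e ∈ G.edgeFinset, (1 + edgeSign x y e)) /
        (A.card : ℝ) ^ 2 - 1) := by
        gcongr with G _
        · have := sq_hit_sub_le_collision A hAne (fun x => edgeIncidence G *ᵥ x) (B G)
          simp only [prod_edges_one_add_edgeSign]
          refine this.trans_eq ?_
          congr!
    _ = (∑ x ∈ A, ∑ y ∈ A, ∑ G, P G * ∏ e ∈ G.edgeFinset, (1 + edgeSign x y e)) /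
        (A.card : ℝ) ^ 2 - 1 := by
        simp only [mul_sub, mul_one, Finset.sum_sub_distrib, hP1]
        congr 1
        simp only [← mul_div_assoc, Finset.mul_sum, ← Finset.sum_div]
        congr 1
        rw [Finset.sum_comm]
        exact Finset.sum_congr rfl fun x _ => Finset.sum_comm
    _ ≤ _ := by
        simp only [hP, sum_binomialRandom_mul_prod]
        have := sum_prod_one_add_edgeSign_le hc hA hn hα hα0 hα1 hcp
        rw [sub_le_iff_le_add, div_le_iff₀ (by positivity)]
        linarith

/-! ### From tests to protocols -/

theorem sum_toReal_pure_mul {β : Type*} [Fintype β] (b : β) (g : β → ℝ) :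
    ∑ b', (PMF.pure b b').toReal * g b' = g b := by
  classical
  simp [PMF.pure_apply, apply_ite ENNReal.toReal, ite_mul]

theorem sum_toReal_bind_mul {β κ : Type*} [Fintype β] [Fintype κ] (q : PMF β) (f : β → PMF κ)
    (g : κ → ℝ) :
    ∑ b, (q.bind f b).toReal * g b = ∑ a, (q a).toReal * ∑ b, (f a b).toReal * g b := by
  have h : ∀ b, (q.bind f b).toReal = ∑ a, (q a).toReal * (f a b).toReal := fun b => by
    rw [PMF.bind_apply, tsum_fintype, ENNReal.toReal_sum fun a _ =>
      ENNReal.mul_ne_top (q.apply_ne_top a) ((f a).apply_ne_top b)]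
    simp [ENNReal.toReal_mul]
  simp_rw [h, Finset.sum_mul, Finset.mul_sum, mul_assoc]
  exact Finset.sum_comm

theorem sum_toReal_map_mul {β κ : Type*} [Fintype β] [Fintype κ] (q : PMF β) (f : β → κ)
    (g : κ → ℝ) : ∑ b, (q.map f b).toReal * g b = ∑ a, (q a).toReal * g (f a) := by
  rw [PMF.map, sum_toReal_bind_mul]
  simp only [Function.comp_apply, sum_toReal_pure_mul]

instance instFiniteBHPInstance (n : ℕ) : Finite (BHPInstance n) := by
  refine Finite.of_injective (β := (Fin n → ZMod 2) ×
    (Σ G : SimpleGraph (Fin n), G.edgeSet → ZMod 2) × Bool)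
    (fun I => (I.x, ⟨I.G, I.w⟩, I.answer)) ?_
  rintro ⟨x, G, w, b⟩ ⟨x', G', w', b'⟩ h
  simp only [Prod.mk.injEq, Sigma.mk.injEq] at h
  obtain ⟨rfl, ⟨rfl, hw⟩, rfl⟩ := h
  cases hw
  rfl

open Classical in
/-- Expectations under the input distribution, written out as finite sums. -/
theorem sum_dbhp_mul {n : ℕ} [Fintype (BHPInstance n)] (p : unitInterval)
    (g : BHPInstance n → ℝ) :
    ∑ I, (dbhp n p I).toReal * g I =
      ∑ x : Fin n → ZMod 2, (1 / 2 ^ n : ℝ) * ∑ G : SimpleGraph (Fin n),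
        ((SimpleGraph.binomialRandom (Fin n) p).toPMF G).toReal *
          (1 / 2 * (g ⟨x, G, edgeIncidence G *ᵥ x, true⟩ +
            (∑ w, g ⟨x, G, w, false⟩) / Fintype.card (G.edgeSet → ZMod 2))) := by
  rw [dbhp, sum_toReal_bind_mul]
  refine Finset.sum_congr rfl fun x _ => ?_
  congr 1
  · simp [PMF.uniformOfFintype_apply, ZMod.card]
  rw [sum_toReal_bind_mul]
  refine Finset.sum_congr rfl fun G _ => ?_
  congr 1
  rw [sum_toReal_bind_mul, Fintype.sum_bool, sum_toReal_map_mul, sum_toReal_map_mul]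
  simp only [bobVector, sum_toReal_pure_mul, PMF.uniformOfFintype_apply, Fintype.card_bool,
    ENNReal.toReal_inv, ENNReal.toReal_natCast, ← Finset.mul_sum]
  push_cast
  ring

/-- There are at most `2 ^ (L + 1)` bit strings of length at most `L`. -/
theorem card_image_lists_le {X : Type*} [Fintype X] (a : X → List Bool) {L : ℕ}
    (ha : ∀ x, (a x).length ≤ L) : (Finset.univ.image a).card ≤ 2 ^ (L + 1) := by
  have hsub : Finset.univ.image a ⊆ (Finset.range (L + 1)).biUnion fun k =>
      (Finset.univ : Finset (Fin k → Bool)).image List.ofFn := by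
    intro l hl
    obtain ⟨x, -, rfl⟩ := Finset.mem_image.1 hl
    refine Finset.mem_biUnion.2 ⟨(a x).length, Finset.mem_range.2 (Nat.lt_succ_of_le (ha x)),
      Finset.mem_image.2 ⟨(a x).get, Finset.mem_univ _, List.ofFn_get _⟩⟩
  calc _ ≤ _ := Finset.card_le_card hsub
    _ ≤ ∑ k ∈ Finset.range (L + 1), 2 ^ k := by
      refine Finset.card_biUnion_le.trans (Finset.sum_le_sum fun k _ => ?_)
      exact Finset.card_image_le.trans (by simp)
    _ ≤ 2 ^ (L + 1) := by
      rw [Nat.geomSum_eq le_rfl]; simp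

open Classical in
/-- A deterministic protocol, split by messages: a message whose class has density at least
`2 ^ (-c)` gives little advantage, and the other classes have total mass at most
`2 ^ (L + 1) / 2 ^ c`, as there are at most `2 ^ (L + 1)` messages. -/
theorem deterministic_success_le {n : ℕ} [Fintype (BHPInstance n)] {c α : ℝ} {p : unitInterval}
    (hc : 1 ≤ c) (hn : 1 ≤ n * α) (hα : n * (p : ℝ) = α) (hα0 : 0 < α) (hα1 : α ≤ 1 / 16)
    (hcp : c * √(p : ℝ) ≤ 1) (a : (Fin n → ZMod 2) → List Bool) {L : ℕ}
    (ha : ∀ x, (a x).length ≤ L)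
    (B : (G : SimpleGraph (Fin n)) → (G.edgeSet → ZMod 2) → List Bool → Bool) :
    ∑ I : BHPInstance n, (dbhp n p I).toReal *
        (if B I.G I.w (a I.x) = I.answer then 1 else 0) ≤
      1 / 2 + (√(6 * α ^ 3 + 64 * Real.exp 8 * (c ^ 2 * p)) + 2 ^ (L + 1) / 2 ^ c) / 2 := by
  set τ := √(6 * α ^ 3 + 64 * Real.exp 8 * (c ^ 2 * p)) with hτ
  set P : SimpleGraph (Fin n) → ℝ :=
    fun G => ((SimpleGraph.binomialRandom (Fin n) p).toPMF G).toReal with hP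
  have hP1 : ∑ G, P G = 1 := sum_toReal_eq_one _
  have hP0 : ∀ G, 0 ≤ P G := fun G => ENNReal.toReal_nonneg
  -- `r` and `hit`: acceptance probability on a uniform `w`, and acceptance of `w = M x`
  set r : SimpleGraph (Fin n) → List Bool → ℝ := fun G m =>
    ((Finset.univ.filter fun w => B G w m = true).card : ℝ) / Fintype.card (G.edgeSet → ZMod 2)
    with hr
  set hit : SimpleGraph (Fin n) → (Fin n → ZMod 2) → List Bool → ℝ := fun G x m =>
    if B G (edgeIncidence G *ᵥ x) m = true then 1 else 0 with hhit
  have hr0 : ∀ G m, 0 ≤ r G m := fun G m => by positivity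
  -- the contribution of a single message
  have hmsg : ∀ m, ∑ x with a x = m, ∑ G, P G * (hit G x m - r G m) ≤
      ((Finset.univ.filter fun x => a x = m).card : ℝ) * τ + 2 ^ n / 2 ^ c := by
    intro m
    set A := Finset.univ.filter fun x => a x = m
    by_cases hA : (2 : ℝ) ^ n ≤ A.card * 2 ^ c
    · have hApos : 0 < (A.card : ℝ) := by
        have : (0 : ℝ) < A.card * 2 ^ c := lt_of_lt_of_le (by positivity) hA
        exact pos_of_mul_pos_left this (by positivity)
      have h := sum_binomialRandom_mul_advantage_le hc hA hn hα hα0 hα1 hcp (fun G w => B G w m)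
      have e : ∑ x ∈ A, ∑ G, P G * (hit G x m - r G m) = A.card * ∑ G, P G *
          (((A.filter fun x => B G (edgeIncidence G *ᵥ x) m = true).card : ℝ) / A.card -
            r G m) := by
        rw [Finset.sum_comm, Finset.mul_sum]
        refine Finset.sum_congr rfl fun G _ => ?_
        rw [← Finset.mul_sum, Finset.sum_sub_distrib, Finset.sum_boole, Finset.sum_const,
          nsmul_eq_mul]
        field_simp
      rw [e]
      have h0 : (0 : ℝ) ≤ 2 ^ n / 2 ^ c := by positivity
      have := mul_le_mul_of_nonneg_left h hApos.le
      linarith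
    · have h1 : ∑ x ∈ A, ∑ G, P G * (hit G x m - r G m) ≤ ∑ x ∈ A, 1 := by
        refine Finset.sum_le_sum fun x _ => ?_
        rw [← hP1]
        refine Finset.sum_le_sum fun G _ => mul_le_of_le_one_right (hP0 G) ?_
        have : hit G x m ≤ 1 := by simp only [hhit]; split_ifs <;> norm_num
        linarith [hr0 G m]
      have h2 : (A.card : ℝ) ≤ 2 ^ n / 2 ^ c := by
        rw [le_div_iff₀ (by positivity)]; exact (not_le.1 hA).le
      have h3 : 0 ≤ (A.card : ℝ) * τ := by positivity
      simp only [Finset.sum_const, nsmul_eq_mul, mul_one] at h1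
      linarith
  have hall : ∑ x, ∑ G, P G * (hit G x (a x) - r G (a x)) ≤
      2 ^ n * τ + 2 ^ (L + 1) * (2 ^ n / 2 ^ c) := by
    rw [← Finset.sum_fiberwise_of_maps_to (g := a) (t := Finset.univ.image a)
      (fun x hx => Finset.mem_image_of_mem a hx)]
    calc _ ≤ ∑ m ∈ Finset.univ.image a,
          (((Finset.univ.filter fun x => a x = m).card : ℝ) * τ + 2 ^ n / 2 ^ c) := by
          refine Finset.sum_le_sum fun m _ => le_trans (le_of_eq ?_) (hmsg m)
          refine Finset.sum_congr rfl fun x hx => ?_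
          rw [(Finset.mem_filter.1 hx).2]
      _ = 2 ^ n * τ + (Finset.univ.image a).card * (2 ^ n / 2 ^ c) := by
          rw [Finset.sum_add_distrib, ← Finset.sum_mul, ← Nat.cast_sum,
            ← Finset.card_eq_sum_card_fiberwise (f := a) (s := Finset.univ)
              (fun x hx => by simp)]
          simp [ZMod.card]
      _ ≤ _ := by
          gcongr
          exact_mod_cast card_image_lists_le a ha
  rw [sum_dbhp_mul]
  have hmiss : ∀ G m, (∑ w : G.edgeSet → ZMod 2, if B G w m = false then (1 : ℝ) else 0) /
      Fintype.card (G.edgeSet → ZMod 2) = 1 - r G m := by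
    intro G m
    have hN : (0 : ℝ) < Fintype.card (G.edgeSet → ZMod 2) := by exact_mod_cast Fintype.card_pos
    have h1 : ∀ w : G.edgeSet → ZMod 2, (if B G w m = false then (1 : ℝ) else 0) =
        1 - if B G w m = true then 1 else 0 := fun w => by cases B G w m <;> simp
    simp only [h1, hr]
    rw [Finset.sum_sub_distrib, Finset.sum_boole, sub_div, Finset.sum_const, nsmul_eq_mul, mul_one,
      Finset.card_univ, div_self hN.ne']
  have hrew : ∀ x : Fin n → ZMod 2, (∑ G, P G *
      (1 / 2 * ((if B G (edgeIncidence G *ᵥ x) (a x) = true then (1 : ℝ) else 0) +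
        (∑ w, if B G w (a x) = false then (1 : ℝ) else 0) /
          Fintype.card (G.edgeSet → ZMod 2)))) =
      1 / 2 + 1 / 2 * ∑ G, P G * (hit G x (a x) - r G (a x)) := by
    intro x
    simp only [hmiss]
    calc _ = ∑ G, (P G * (1 / 2) + 1 / 2 * (P G * (hit G x (a x) - r G (a x)))) :=
          Finset.sum_congr rfl fun G _ => by simp only [hhit]; ring
      _ = _ := by
        rw [Finset.sum_add_distrib, ← Finset.sum_mul, hP1, one_mul, ← Finset.mul_sum]
  have hx : ∑ x : Fin n → ZMod 2, (1 / 2 ^ n : ℝ) * (1 / 2 + 1 / 2 * ∑ G, P G *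
      (hit G x (a x) - r G (a x))) =
      1 / 2 + 1 / 2 * ((1 / 2 ^ n : ℝ) * ∑ x, ∑ G, P G * (hit G x (a x) - r G (a x))) := by
    rw [← Finset.mul_sum, Finset.sum_add_distrib, ← Finset.mul_sum, Finset.sum_const,
      Finset.card_univ]
    simp only [Fintype.card_pi, ZMod.card, Finset.prod_const, Finset.card_univ, Fintype.card_fin,
      nsmul_eq_mul]
    push_cast
    field_simp
  calc _ = ∑ x : Fin n → ZMod 2, (1 / 2 ^ n : ℝ) * (1 / 2 + 1 / 2 * ∑ G, P G *
      (hit G x (a x) - r G (a x))) :=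
        Finset.sum_congr rfl fun x _ => by rw [← hrew x]
    _ ≤ 1 / 2 + 1 / 2 * ((1 / 2 ^ n : ℝ) * (2 ^ n * τ + 2 ^ (L + 1) * (2 ^ n / 2 ^ c))) := by
        rw [hx]; gcongr
    _ = _ := by field_simp

theorem measurableSet_output_eq {n : ℕ} {Ω : Type*} [MeasurableSpace Ω] (P : OneWayProtocol n Ω)
    (I : BHPInstance n) : MeasurableSet {ω | P.output ω I = I.answer} := by
  have h : {ω | P.output ω I = I.answer} =
      ⋃ m : List Bool, {ω | P.alice ω I.x = m} ∩ {ω | P.bob ω I.G I.w m = I.answer} := by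
    ext ω
    simp [OneWayProtocol.output]
  rw [h]
  refine MeasurableSet.iUnion fun m => (P.measurableSet_alice _ m).inter ?_
  have hb := P.measurableSet_bob I.G I.w m
  rcases I.answer with _ | _
  · convert hb.compl using 1
    ext ω; simp
  · exact hb

/-- A randomized protocol is at most as good as its best choice of coins. -/
theorem successProb_le {n : ℕ} [Fintype (BHPInstance n)] {Ω : Type*} [MeasurableSpace Ω]
    (μ : Measure Ω) [IsProbabilityMeasure μ] (P : OneWayProtocol n Ω) (p : unitInterval) {β : ℝ}
    (h : ∀ ω, ∑ I : BHPInstance n, (dbhp n p I).toReal *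
      (if P.output ω I = I.answer then 1 else 0) ≤ β) : P.successProb μ p ≤ β := by
  have e : P.successProb μ p = ∫ ω, ∑ I : BHPInstance n, (dbhp n p I).toReal *
      Set.indicator {ω | P.output ω I = I.answer} (fun _ => (1 : ℝ)) ω ∂μ := by
    have hint : ∀ I : BHPInstance n, Integrable (fun ω => (dbhp n p I).toReal *
        Set.indicator {ω | P.output ω I = I.answer} (fun _ => (1 : ℝ)) ω) μ := fun I =>
      ((integrable_const 1).indicator (measurableSet_output_eq P I)).const_mul _
    rw [integral_finsetSum _ fun I _ => hint I, OneWayProtocol.successProb, tsum_fintype,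
      ENNReal.toReal_sum fun I _ => ENNReal.mul_ne_top ((dbhp n p).apply_ne_top I)
        (measure_ne_top μ _)]
    refine Finset.sum_congr rfl fun I _ => ?_
    rw [integral_const_mul, integral_indicator_const _ (measurableSet_output_eq P I),
      ENNReal.toReal_mul]
    simp [measureReal_def]
  rw [e]
  have hb : ∀ ω, ∑ I : BHPInstance n, (dbhp n p I).toReal *
      Set.indicator {ω | P.output ω I = I.answer} (fun _ => (1 : ℝ)) ω ≤ β := fun ω => by
    simpa [Set.indicator_apply] using h ω
  calc _ ≤ ∫ _, β ∂μ := by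
        refine integral_mono (integrable_finsetSum _ fun I _ =>
          ((integrable_const 1).indicator (measurableSet_output_eq P I)).const_mul _)
          (integrable_const _) hb
    _ = β := by simp

theorem lemma4p1 :
    ∃ C : ℝ, 0 < C ∧
      ∀ (n : ℕ) (γ α : ℝ), 0 < n →
        (n : ℝ) ^ (-(1 / 10) : ℝ) < γ → γ < 1 →
        (n : ℝ) ^ (-(1 / 10) : ℝ) < α → α < 1 / 16 →
        ∀ p : unitInterval, (p : ℝ) = α / n →
        ∀ (Ω : Type*) [MeasurableSpace Ω] (μ : Measure Ω) [IsProbabilityMeasure μ]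
          (P : OneWayProtocol n Ω),
          P.UsesAtMost (γ * √(n : ℝ)) →
          ∀ δ : ℝ, P.AchievesAdvantage μ p δ →
            δ ≤ C * (γ + α ^ (3 / 2 : ℝ)) := by
  refine ⟨24 * Real.exp 4 + 3, by positivity, ?_⟩
  intro n γ α hn hγ hγ1 hα hα1 p hp Ω _ μ _ P hP δ hδ
  have hn1 : (1 : ℝ) ≤ n := by exact_mod_cast hn
  have hn0 : (0 : ℝ) < n := by linarith
  have hb0 : 0 < (n : ℝ) ^ (-(1 / 10) : ℝ) := Real.rpow_pos_of_pos hn0 _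
  have hγ0 : 0 < γ := hb0.trans hγ
  have hα0 : 0 < α := hb0.trans hα
  have hnp : n * (p : ℝ) = α := by rw [hp]; field_simp
  have hnα : 1 ≤ n * α := by
    have h1 : (n : ℝ) ^ (-1 : ℝ) ≤ α :=
      (Real.rpow_le_rpow_of_exponent_le hn1 (by norm_num)).trans hα.le
    rw [Real.rpow_neg_one] at h1
    calc (1 : ℝ) = n * (n : ℝ)⁻¹ := by field_simp
      _ ≤ _ := by gcongr
  set y := γ * √(n : ℝ) with hy
  have hyγ : 1 ≤ y * γ := by
    have h1 : (n : ℝ) ^ (-(1 / 4) : ℝ) ≤ γ :=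
      (Real.rpow_le_rpow_of_exponent_le hn1 (by norm_num)).trans hγ.le
    have h2 : (n : ℝ) ^ (-(1 / 4) : ℝ) * √(n : ℝ) * (n : ℝ) ^ (-(1 / 4) : ℝ) = 1 := by
      rw [Real.sqrt_eq_rpow, ← Real.rpow_add hn0, ← Real.rpow_add hn0]
      norm_num
    rw [← h2, hy]
    gcongr
  have hy0 : 0 ≤ y := by positivity
  have hy1 : 1 ≤ y := by nlinarith
  have h2y : (2 : ℝ) ^ (-y) ≤ γ := by
    have h1 : y ≤ 2 ^ y := by
      have := one_add_mul_self_le_rpow_one_add (s := 1) (by norm_num) hy1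
      norm_num at this
      linarith
    rw [Real.rpow_neg (by norm_num), inv_le_iff_one_le_mul₀ (by positivity)]
    nlinarith
  -- `2 ^ (y + 1)` messages times the density threshold `2 ^ (-c)` is `2 ^ (-y) ≤ γ`
  set c := 2 * y + 1 with hc
  have hsp : √(p : ℝ) * √(n : ℝ) = √α := by
    rw [← Real.sqrt_mul p.2.1, mul_comm, hnp]
  have hc3 : c ≤ 3 * y := by linarith
  have hcp' : c * √(p : ℝ) ≤ 3 * γ * √α := by
    calc c * √(p : ℝ) ≤ 3 * y * √(p : ℝ) := by gcongr
      _ = 3 * γ * (√(p : ℝ) * √(n : ℝ)) := by rw [hy]; ring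
      _ = _ := by rw [hsp]
  have hsα : √α ≤ 1 / 4 := by
    rw [Real.sqrt_le_left (by norm_num)]
    norm_num; linarith
  have hcp : c * √(p : ℝ) ≤ 1 := by
    have : γ * √α ≤ 1 * (1 / 4) := by gcongr
    linarith
  have hc2p : c ^ 2 * (p : ℝ) ≤ 9 * γ ^ 2 := by
    calc c ^ 2 * (p : ℝ) = (c * √(p : ℝ)) ^ 2 := by rw [mul_pow, Real.sq_sqrt p.2.1]
      _ ≤ (3 * γ * √α) ^ 2 := by gcongr
      _ = 9 * γ ^ 2 * α := by rw [mul_pow, Real.sq_sqrt hα0.le]; ring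
      _ ≤ _ := mul_le_of_le_one_right (by positivity) (by linarith)
  set t := α ^ (3 / 2 : ℝ) with ht
  have ht0 : 0 ≤ t := by positivity
  have ht2 : α ^ 3 = t ^ 2 := by
    rw [ht, ← Real.rpow_natCast (α ^ (3 / 2 : ℝ)), ← Real.rpow_mul hα0.le, ← Real.rpow_natCast]
    norm_num
  have hτ : √(6 * α ^ 3 + 64 * Real.exp 8 * (c ^ 2 * p)) ≤ 3 * t + 24 * Real.exp 4 * γ := by
    rw [Real.sqrt_le_left (by positivity), ht2]
    have he : Real.exp 8 = Real.exp 4 ^ 2 := by rw [sq, ← Real.exp_add]; norm_num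
    have h1 : 64 * Real.exp 8 * (c ^ 2 * p) ≤ 64 * Real.exp 4 ^ 2 * (9 * γ ^ 2) := by
      rw [← he]; gcongr
    have h2 : 0 ≤ t * (Real.exp 4 * γ) := by positivity
    nlinarith [sq_nonneg t]
  have hL : (2 : ℝ) ^ (⌊y⌋₊ + 1) / 2 ^ c ≤ γ := by
    refine le_trans ?_ h2y
    rw [← Real.rpow_natCast, ← Real.rpow_sub (by norm_num)]
    apply Real.rpow_le_rpow_of_exponent_le (by norm_num)
    push_cast
    linarith [Nat.floor_le hy0]
  have := Fintype.ofFinite (BHPInstance n)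
  have hs : P.successProb μ p ≤ _ := successProb_le μ P p fun ω =>
    deterministic_success_le (c := c) (by linarith) hnα hnp hα0 hα1.le hcp (P.alice ω)
      (L := ⌊y⌋₊) (fun x => Nat.le_floor (hP ω x)) (P.bob ω)
  have hδ' : 1 / 2 + δ ≤ P.successProb μ p := hδ
  have he : 0 ≤ Real.exp 4 * t := by positivity
  nlinarith [mul_pos (Real.exp_pos 4) hγ0]
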